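/- Let $k$ be an algebraically closed field, let $n\ge 1$ be an integer that is not divisible by $\operatorname{char} k$, let $\xi\in k$ be a primitive $n$-th root of unity, and let $a$ be a natural number coprime to $n$. Let $G=\frac1n(1,a)\subseteq \mathrm{GL}(2,k)$ be the (small) cyclic group of order $n$ generated by the diagonal matrix $\operatorname{diag}(\xi,\xi^a)$, acting on $k[[u,v]]$ by linear changes of variables, and let $R=k[[u,v]]^G$ be its ring of invariants, a Noetherian local domain of dimension $2$ with residue field $k$. For $q\in\mathbb N$ put $$\mathcal S^q=\bigl(\operatorname{Sym}^q_R(\operatorname{Syz}^{2}_R(k))\bigr)^{**},$$ where $\operatorname{Syz}^2_R(k)$ is the second syzygy module of $k$ in a minimal free resolution over $R$ and $(-)^*=\operatorname{Hom}_R(-,R)$. For a finitely generated $R$-module $X$ let $\operatorname{rank}_R X$ be the dimension of $X\otimes_R \operatorname{Frac}(R)$ over $\operatorname{Frac}(R)$, and let $\operatorname{frk}_R X$ be the largest $m$ such that there is a split surjection $X\to R^m$. (1) Let $M$ be an indecomposable maximal Cohen–Macaulay $R$-module, i.e. an indecomposable finitely generated $R$-module with $\operatorname{depth}_R M=\dim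 R$. For every $q$ there is exactly one $a_q\in\mathbb N$ such that $\mathcal S^q\cong M^{a_q}\oplus N_q$ for a module $N_q$ without direct summand isomorphic to $M$, and the generalized symmetric signature of $R$ with respect to $M$ exists and is $$s_\sigma(R,M)=\lim_{N\to\infty}\frac{\sum_{q=0}^N a_q}{\sum_{q=0}^N\operatorname{rank}_R\mathcal S^q}=\frac1{|G|}.$$ (2) The symmetric signature of $R$ exists and is $$s_\sigma(R)=\lim_{N\to\infty}\frac{\sum_{q=0}^N\operatorname{frk}_R\mathcal S^q}{\sum_{q=0}^N\operatorname{rank}_R\mathcal S^q}=\frac1{|G|}.$$ -/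

import Mathlib

open Filter Topology

universe u v w

noncomputable section

namespace SymmetricSignature

/-! ### Modules over commutative and local rings -/

section Modules

variable (R : Type u) [CommRing R]

/-- The rank of a module over a domain: the dimension of its localization at all nonzero elements,
as a vector space over the fraction field. -/
def rank [IsDomain R] (M : Type v) [AddCommGroup M] [Module R M] : ℕ :=
  Module.finrank (FractionRing R) (LocalizedModule (nonZeroDivisors R) M)

/-- The free rank of a (finitely generated) module `M`: the largest `n` such that there is a split
surjection `M → Rⁿ`. -/
def freeRank (M : Type v) [AddCommGroup M] [Module R M] : ℕ :=
  sSup {n : ℕ | ∃ (φ : M →ₗ[R] (Fin n → R)) (ψ : (Fin n → R) →ₗ[R] M), φ ∘ₗ ψ = LinearMap.id}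

/-- A nonzero module is indecomposable if in each decomposition as an (internal) direct sum of two
submodules one of them is zero. -/
def IsIndecomposable (M : Type v) [AddCommGroup M] [Module R M] : Prop :=
  Nontrivial M ∧ ∀ A B : Submodule R M, IsCompl A B → A = ⊥ ∨ B = ⊥

/-- `X` has a direct summand isomorphic to `M`. -/
def HasSummand (M : Type v) [AddCommGroup M] [Module R M]
    (X : Type w) [AddCommGroup X] [Module R X] : Prop :=
  ∃ P N : Submodule R X, IsCompl P N ∧ Nonempty (P ≃ₗ[R] M)

/-- `X = Mᵃ ⊕ N`, where `N` has no direct summand isomorphic to `M`. -/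
def IsMultiplicity (M : Type v) [AddCommGroup M] [Module R M]
    (X : Type w) [AddCommGroup X] [Module R X] (a : ℕ) : Prop :=
  ∃ P N : Submodule R X, IsCompl P N ∧ Nonempty (P ≃ₗ[R] (Fin a → M)) ∧ ¬ HasSummand R M N

/-- The depth of a module over a local ring: the supremum of the lengths of the `M`-regular
sequences in the maximal ideal. -/
def depth [IsLocalRing R] (M : Type v) [AddCommGroup M] [Module R M] : ℕ∞ :=
  ⨆ rs ∈ {rs : List R | (∀ r ∈ rs, r ∈ IsLocalRing.maximalIdeal R) ∧
    RingTheory.Sequence.IsRegular M rs}, (rs.length : ℕ∞)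

/-- Maximal Cohen-Macaulay modules: finitely generated modules with `depth M = dim R`. -/
def IsMCM [IsLocalRing R] (M : Type v) [AddCommGroup M] [Module R M] : Prop :=
  Module.Finite R M ∧ (depth R M : WithBot ℕ∞) = ringKrullDim R

/-- The map from the free module on a minimal system of generators of `M` onto `M`
(`Submodule.generators` is a generating set of the least possible cardinality). -/
def minimalCover (M : Type v) [AddCommGroup M] [Module R M] :
    ((⊤ : Submodule R M).generators →₀ R) →ₗ[R] M :=
  Finsupp.linearCombination R Subtype.val

/-- The `n`-th syzygy module of `M` in the minimal free resolution of `M`, which is built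
step by step by covering the previous syzygy by the free module on a minimal system of
generators. -/
def syzygy : ℕ → ModuleCat.{u} R → ModuleCat.{u} R
  | 0, M => M
  | n + 1, M => ModuleCat.of R (LinearMap.ker (minimalCover R (syzygy n M)))

/-- The `q`-th reflexive symmetric power `(Sym^q M)^{**}`. -/
abbrev ReflexiveSymmetricPower (q : ℕ) (M : Type v) [AddCommGroup M] [Module R M] :
    Type (max u v) :=
  Module.Dual R (Module.Dual R (SymmetricPower R (ULift.{u} (Fin q)) M))

end Modules

/-! ### The symmetric signature of a Noetherian local domain -/

section Signature

variable (R : Type u) [CommRing R] [IsDomain R] [IsLocalRing R]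

/-- The Krull dimension of a Noetherian local ring, as a natural number. -/
def dim : ℕ := ((ringKrullDim R).unbotD 0).toNat

/-- `𝒮^q = (Sym^q(Syz^d(k)))^{**}`, where `k` is the residue field and `d` the dimension
of `R`. -/
abbrev SymSyz (q : ℕ) : Type u :=
  ReflexiveSymmetricPower R q
    (syzygy R (dim R) (ModuleCat.of R (IsLocalRing.ResidueField R)))

/-- The symmetric signature of `R` exists and is equal to `s`. -/
def HasSymmetricSignature (s : ℝ) : Prop :=
  Tendsto (fun N : ℕ =>
      (∑ q ∈ Finset.range (N + 1), (freeRank R (SymSyz R q) : ℝ)) /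
        ∑ q ∈ Finset.range (N + 1), (rank R (SymSyz R q) : ℝ))
    atTop (𝓝 s)

/-- The generalized symmetric signature of `R` with respect to `M` exists and is equal to `s`:
the multiplicities `a q` of `M` in the modules `𝒮^q` are well defined, and the limit of the
quotients of the sums of the multiplicities and of the ranks is `s`. -/
def HasGeneralizedSymmetricSignature (M : Type v) [AddCommGroup M] [Module R M] (s : ℝ) : Prop :=
  ∃ a : ℕ → ℕ, (∀ q b, IsMultiplicity R M (SymSyz R q) b ↔ b = a q) ∧
    Tendsto (fun N : ℕ =>
        (∑ q ∈ Finset.range (N + 1), (a q : ℝ)) /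
          ∑ q ∈ Finset.range (N + 1), (rank R (SymSyz R q) : ℝ))
      atTop (𝓝 s)

end Signature

/-! ### Invariant rings of linear groups and the groups `(1/n)(1,a)` -/

section Invariants

variable {k : Type u} [Field k]

theorem hasSubst_linear (g : GL (Fin 2) k) :
    MvPowerSeries.HasSubst
      (fun j => ∑ i, g i j • (MvPowerSeries.X i : MvPowerSeries (Fin 2) k)) :=
  MvPowerSeries.hasSubst_of_constantCoeff_zero fun j => by simp

/-- The action of a matrix `g` on `k[[x₀, x₁]]` by the linear change of variables
`x_j ↦ ∑ i, g i j x_i`. -/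
def linearAction (g : GL (Fin 2) k) :
    MvPowerSeries (Fin 2) k →ₐ[k] MvPowerSeries (Fin 2) k :=
  MvPowerSeries.substAlgHom (hasSubst_linear g)

/-- The invariant ring `k[[x₀, x₁]]^G`. -/
def invariantRing (G : Subgroup (GL (Fin 2) k)) : Subalgebra k (MvPowerSeries (Fin 2) k) where
  carrier := {f | ∀ g ∈ G, linearAction g f = f}
  mul_mem' hx hy g hg := by rw [map_mul, hx g hg, hy g hg]
  add_mem' hx hy g hg := by rw [map_add, hx g hg, hy g hg]
  algebraMap_mem' r g _ := AlgHom.commutes _ r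

instance (G : Subgroup (GL (Fin 2) k)) : IsDomain (invariantRing G) :=
  have : IsDomain (MvPowerSeries (Fin 2) k) := NoZeroDivisors.to_isDomain _
  inferInstance

instance (G : Subgroup (GL (Fin 2) k)) : IsLocalRing (invariantRing G) := by
  have key : ∀ x : invariantRing G, IsUnit (x : MvPowerSeries (Fin 2) k) → IsUnit x := by
    rintro ⟨x, hx⟩ hu
    obtain ⟨y, hy⟩ := hu.exists_right_inv
    have hmem : y ∈ invariantRing G := fun g hg => by
      have h1 : x * linearAction g y = 1 := by
        rw [← map_one (linearAction g), ← hy, map_mul, hx g hg]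
      exact mul_left_cancel₀ hu.ne_zero (h1.trans hy.symm)
    exact IsUnit.of_mul_eq_one ⟨y, hmem⟩ (Subtype.ext hy)
  refine IsLocalRing.of_isUnit_or_isUnit_one_sub_self fun x => ?_
  rcases IsLocalRing.isUnit_or_isUnit_one_sub_self (x : MvPowerSeries (Fin 2) k) with h | h
  · exact Or.inl (key x h)
  · exact Or.inr (key (1 - x) h)

/-- The diagonal matrix with entries `ξ`, `ξ ^ a`. -/
def diagGenerator (ξ : kˣ) (a : ℕ) : GL (Fin 2) k :=
  Matrix.GeneralLinearGroup.mkOfDetNeZero (Matrix.diagonal ![(ξ : k), (ξ : k) ^ a])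
    (by simp [Matrix.det_diagonal])

/-- The cyclic subgroup of `GL(2, k)` generated by the diagonal matrix with entries `ξ`, `ξ ^ a`.
If `ξ` is a primitive `n`-th root of unity, this is the group `(1/n)(1,a)`. -/
def cyclicGroup (ξ : kˣ) (a : ℕ) : Subgroup (GL (Fin 2) k) :=
  Subgroup.zpowers (diagGenerator ξ a)

/-- The cyclic quotient singularity `k[[u, v]]^G` for the group `G = (1/n)(1,a)` attached to a
primitive `n`-th root of unity `ξ`. -/
abbrev cyclicSingularity (ξ : kˣ) (a : ℕ) : Subalgebra k (MvPowerSeries (Fin 2) k) :=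
  invariantRing (cyclicGroup ξ a)

end Invariants

end SymmetricSignature

end

noncomputable section

namespace SymmetricSignature

open MvPowerSeries IsLocalRing RingTheory.Sequence

/-! The ring `S = k[[u, v]]` is graded by the finite character group `Γ` of `G`; `R` is the part of
weight zero, and `S = ⊕ S_χ` over `R`.

A finitely generated graded `S`-module with vanishing first Koszul homology on `u, v` is free on
homogeneous elements, hence its part of weight zero is a direct sum of modules `S_χ`. Applied to
`Hom_R(S, M)`, this shows that an indecomposable maximal Cohen–Macaulay module `M` is isomorphic to
some `S_χ`. Applied to the `S`-linear relations between generators of the maximal ideal of `R`, it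
shows that `Syz²(k) ≅ ⊕_t S_{χ_t}`. The relation `v · u^n = u^{m+1} · u^{n-m-1} v` between the
invariants `u^n` and `u^{n-m-1} v` is not in the maximal ideal of `S` times the relations, and its
weight, that of `v`, generates `Γ`; hence some `χ_t` generates `Γ`.

The weight of `u` and the weight of `v` both generate `Γ`, which forces
`Hom_R(S_χ, S_ψ) = S_{ψ - χ}`. Hence `Sym^q(⊕_t S_{χ_t})^{**}` is the direct sum of the `S_{χ_m}`
over the monomials `m` of degree `q` in the indices `t`, where `χ_m` is the sum of the `χ_t`. Since
the endomorphism rings of the `S_χ` are local, the multiplicities count monomials by weight.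
Multiplication by an index `t` whose `χ_t` generates `Γ` shifts the weights by `χ_t`, so up to the
monomials of top degree, which are negligible, all weights occur equally often. -/

/-! ### Regular pairs -/

section RegularPairs

variable {R N : Type*} [CommRing R] [AddCommGroup N] [Module R N]

theorem isWeaklyRegular_pair_iff {x y : R} :
    IsWeaklyRegular N [x, y] ↔
      (∀ z : N, x • z = 0 → z = 0) ∧ ∀ z w : N, y • z = x • w → ∃ t, z = x • t := by
  rw [isWeaklyRegular_cons_iff, isWeaklyRegular_singleton_iff,
    isSMulRegular_iff_right_eq_zero_of_smul, isSMulRegular_iff_right_eq_zero_of_smul,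
    (Submodule.Quotient.mk_surjective _).forall]
  have mk_eq_zero (z : N) :
      (Submodule.Quotient.mk z : QuotSMulTop x N) = 0 ↔ ∃ t, z = x • t := by
    rw [Submodule.Quotient.mk_eq_zero, Submodule.mem_smul_pointwise_iff_exists]
    simp only [Submodule.mem_top, true_and, eq_comm]
  simp only [← Submodule.Quotient.mk_smul, mk_eq_zero, forall_exists_index]

variable (N) in
/-- The vanishing of the first homology of the Koszul complex of `u`, `v` on `N`. Over a regular
local ring with maximal ideal `(u, v)` it characterizes the free modules. -/
def IsKoszulExact (u v : R) : Prop :=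
  ∀ ⦃z w : N⦄, u • w = v • z → ∃ t, z = u • t ∧ w = v • t

theorem IsKoszulExact.of_isWeaklyRegular {x y u v : R}
    (hx : x ∈ Ideal.span {u, v}) (hy : y ∈ Ideal.span {u, v})
    (hxy : IsWeaklyRegular N [x, y]) :
    IsKoszulExact N u v := by
  intro z w h
  obtain ⟨hx0, hxy⟩ := isWeaklyRegular_pair_iff.1 hxy
  have smul_eq {s : R} (hs : s ∈ Ideal.span {u, v}) : ∃ t, s • z = u • t ∧ s • w = v • t := by
    obtain ⟨p, q, rfl⟩ := Ideal.mem_span_pair.1 hs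
    refine ⟨p • z + q • w, ?_, ?_⟩
    · rw [add_smul, mul_smul, mul_smul, ← h, smul_add, smul_comm u p, smul_comm u q]
    · rw [add_smul, mul_smul, mul_smul, h, smul_add, smul_comm v p, smul_comm v q]
  have eq_of_smul_eq {a b : N} (hu : u • a = u • b) (hv : v • a = v • b) : a = b := by
    obtain ⟨p, q, rfl⟩ := Ideal.mem_span_pair.1 hx
    refine sub_eq_zero.1 (hx0 _ ?_)
    rw [add_smul, mul_smul, mul_smul, smul_sub u, smul_sub v, hu, hv, sub_self, sub_self,
      smul_zero, smul_zero, add_zero]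
  obtain ⟨a, hza, hwa⟩ := smul_eq hx
  obtain ⟨b, hzb, hwb⟩ := smul_eq hy
  obtain ⟨t, rfl⟩ := hxy a b <| eq_of_smul_eq
    (by rw [smul_comm, ← hza, smul_comm u, ← hzb, smul_comm])
    (by rw [smul_comm, ← hwa, smul_comm v, ← hwb, smul_comm])
  refine ⟨t, sub_eq_zero.1 (hx0 _ ?_), sub_eq_zero.1 (hx0 _ ?_)⟩
  · rw [smul_sub, hza, smul_comm, sub_self]
  · rw [smul_sub, hwa, smul_comm, sub_self]

theorem exists_isWeaklyRegular_pair_of_two_le_depth [IsLocalRing R] (h : 2 ≤ depth R N) :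
    ∃ x ∈ maximalIdeal R, ∃ y ∈ maximalIdeal R, IsWeaklyRegular N [x, y] := by
  have h1 : 1 < depth R N := lt_of_lt_of_le (by norm_num) h
  simp only [depth, lt_iSup_iff] at h1
  obtain ⟨rs, ⟨hmem, hreg⟩, hlen⟩ := h1
  match rs, hmem, hreg, hlen with
  | [], _, _, hlen => simp at hlen
  | [x], _, _, hlen => simp at hlen
  | x :: y :: l, hmem, hreg, _ =>
    have hxy := ((isWeaklyRegular_append_iff N [x, y] l).1 hreg.toIsWeaklyRegular).1
    exact ⟨x, hmem x (by simp), y, hmem y (by simp), hxy⟩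

theorem ringKrullDim_eq_two_of_isWeaklyRegular [IsLocalRing R] [IsNoetherianRing R] {x y : R}
    (hx : x ∈ maximalIdeal R) (hy : y ∈ maximalIdeal R) (hxy : IsWeaklyRegular R [x, y])
    (hrad : maximalIdeal R ≤ (Ideal.span {x, y}).radical) : ringKrullDim R = 2 := by
  have hmem : ∀ r ∈ [x, y], r ∈ maximalIdeal R := by simpa using ⟨hx, hy⟩
  have hspan : Ideal.ofList [x, y] = Ideal.span {x, y} := by
    simp [Ideal.span_insert]
  have hdim : Ring.KrullDimLE 0 (R ⧸ Ideal.ofList [x, y]) := by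
    rw [Ideal.krullDimLE_zero_quotient_iff_forall_minimalPrimes_isMaximal, hspan]
    rintro P ⟨⟨hP, hle⟩, -⟩
    have : maximalIdeal R ≤ P := hrad.trans (hP.radical_le_iff.2 hle)
    rw [← (maximalIdeal.isMaximal R).eq_of_le hP.ne_top this]
    exact maximalIdeal.isMaximal R
  have hne : Ideal.ofList [x, y] ≠ ⊤ := fun h =>
    (maximalIdeal.isMaximal R).ne_top (top_le_iff.1 (h ▸ Ideal.span_le.2 hmem))
  have : Nontrivial (R ⧸ Ideal.ofList [x, y]) := Ideal.Quotient.nontrivial_iff.2 hne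
  rw [← ringKrullDim_add_length_eq_ringKrullDim_of_isRegular [x, y]
    (.of_isWeaklyRegular_of_mem_maximalIdeal _ hmem hxy),
    ringKrullDimZero_iff_ringKrullDim_eq_zero.1 hdim]
  rfl

end RegularPairs

/-! ### Free modules over two-dimensional regular local rings -/

section MinimalGenerators

variable {S N ι : Type*} [CommRing S] [AddCommGroup N] [Module S N]

theorem eq_zero_of_forall_mem_span_pair_mul [IsLocalRing S] [IsNoetherianRing S]
    {u v : S} (huv : maximalIdeal S = Ideal.span {u, v}) {C : Set (ι → S)}
    (hC : ∀ c ∈ C, ∃ p ∈ C, ∃ q ∈ C, c = u • p + v • q) {c : ι → S} (hc : c ∈ C) : c = 0 := by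
  have mem_pow (j : ℕ) : ∀ c ∈ C, ∀ i, c i ∈ maximalIdeal S ^ j := by
    induction j with
    | zero => simp
    | succ j ih =>
      intro c hc i
      obtain ⟨p, hp, q, hq, rfl⟩ := hC c hc
      rw [pow_succ']
      refine add_mem (Ideal.mul_mem_mul ?_ (ih p hp i)) (Ideal.mul_mem_mul ?_ (ih q hq i)) <;>
        exact huv ▸ Ideal.subset_span (by simp)
  funext i
  rw [Pi.zero_apply, ← Ideal.mem_bot, ← Ideal.iInf_pow_eq_bot_of_isLocalRing (maximalIdeal S)
    (Ideal.IsPrime.ne_top inferInstance), Ideal.mem_iInf]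
  exact fun j => mem_pow j c hc i

variable [Fintype ι] {e : ι → N}

theorem linearIndependent_of_relations_mem_maximalIdeal [IsLocalRing S] [IsNoetherianRing S]
    {u v : S} (huv : maximalIdeal S = Ideal.span {u, v})
    (hN : IsKoszulExact N u v)
    (hspan : Submodule.span S (Set.range e) = ⊤)
    (hmin : ∀ c : ι → S, ∑ i, c i • e i = 0 → ∀ i, c i ∈ maximalIdeal S) :
    LinearIndependent S e := by
  rw [Fintype.linearIndependent_iff]
  refine fun c hc => congrFun (eq_zero_of_forall_mem_span_pair_mul huv
    (C := {c | ∑ i, c i • e i = 0}) (fun c hc => ?_) hc)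
  have hcuv i : ∃ p q, p * u + q * v = c i := Ideal.mem_span_pair.1 (huv ▸ hmin c hc i)
  choose p q hpq using hcuv
  have hrel : v • ∑ i, q i • e i = u • -∑ i, p i • e i := by
    have hsum : u • ∑ i, p i • e i + v • ∑ i, q i • e i = 0 := by
      rw [← hc, Finset.smul_sum, Finset.smul_sum, ← Finset.sum_add_distrib]
      refine Finset.sum_congr rfl fun i _ => ?_
      rw [← hpq i, add_smul, mul_comm, mul_smul, mul_comm, mul_smul]
    rw [smul_neg, eq_neg_iff_add_eq_zero, add_comm, hsum]
  obtain ⟨t, hq, hp⟩ := hN hrel.symm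
  obtain ⟨c', rfl⟩ := (Submodule.mem_span_range_iff_exists_fun S).1 (hspan.ge trivial : t ∈ _)
  refine ⟨p + v • c', ?_, q - u • c', ?_, funext fun i => ?_⟩
  · simp [add_smul, mul_smul, Finset.sum_add_distrib, ← Finset.smul_sum, ← hp]
  · simp [sub_smul, mul_smul, Finset.sum_sub_distrib, ← Finset.smul_sum, ← hq]
  · rw [← hpq i]
    simp only [Pi.add_apply, Pi.smul_apply, Pi.sub_apply, smul_eq_mul]
    ring

theorem span_compl_singleton_eq_top_of_isUnit (hspan : Submodule.span S (Set.range e) = ⊤)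
    {c : ι → S} (hc : ∑ i, c i • e i = 0) {i : ι} (hi : IsUnit (c i)) :
    Submodule.span S (e '' {i}ᶜ) = ⊤ := by
  classical
  rw [eq_top_iff, ← hspan, Submodule.span_le]
  rintro _ ⟨j, rfl⟩
  rcases eq_or_ne j i with rfl | hj
  · rw [SetLike.mem_coe, ← Submodule.smul_mem_iff_of_isUnit _ hi,
      eq_neg_of_add_eq_zero_left ((Fintype.sum_eq_add_sum_compl j _).symm.trans hc)]
    exact neg_mem (sum_mem fun l hl => Submodule.smul_mem _ _
      (Submodule.subset_span ⟨l, by simpa using hl, rfl⟩))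
  · exact Submodule.subset_span ⟨j, hj, rfl⟩

end MinimalGenerators

/-! ### Power series over a field -/

section PowerSeries

variable {σ k : Type*} [Field k]

instance isDomain_mvPowerSeries : IsDomain (MvPowerSeries σ k) := NoZeroDivisors.to_isDomain _

theorem X_ne_zero (s : σ) : (X s : MvPowerSeries σ k) ≠ 0 :=
  nonZeroDivisors.ne_zero X_mem_nonzeroDivisors

theorem isUnit_iff_constantCoeff_ne_zero {f : MvPowerSeries σ k} :
    IsUnit f ↔ constantCoeff f ≠ 0 :=
  isUnit_iff_constantCoeff.trans isUnit_iff_ne_zero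

theorem mem_maximalIdeal_iff_constantCoeff_eq_zero {f : MvPowerSeries σ k} :
    f ∈ maximalIdeal (MvPowerSeries σ k) ↔ constantCoeff f = 0 := by
  rw [mem_maximalIdeal, mem_nonunits_iff, isUnit_iff_constantCoeff_ne_zero, not_not]

theorem X_pow_dvd_of_dvd_X_pow_mul {s t : σ} (hst : s ≠ t) {i j : ℕ} {f : MvPowerSeries σ k}
    (h : X s ^ i ∣ X t ^ j * f) : X s ^ i ∣ f := by
  classical
  rw [X_pow_dvd_iff] at h ⊢
  intro m hm
  have := h (Finsupp.single t j + m) (by simpa [Finsupp.single_apply, hst.symm] using hm)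
  rwa [X_pow_eq, coeff_add_monomial_mul, one_mul] at this

theorem isWeaklyRegular_X_pow_X_pow {s t : σ} (hst : s ≠ t) (i j : ℕ) :
    IsWeaklyRegular (MvPowerSeries σ k) [(X s ^ i : MvPowerSeries σ k), X t ^ j] :=
  isWeaklyRegular_pair_iff.2
    ⟨fun _ h => (smul_eq_zero.1 h).resolve_left (pow_ne_zero i (X_ne_zero s)),
      fun z w h => (X_pow_dvd_of_dvd_X_pow_mul hst ⟨w, h⟩ : X s ^ i ∣ z)⟩

theorem maximalIdeal_eq_span_X_pair :
    maximalIdeal (MvPowerSeries (Fin 2) k) = Ideal.span {X 0, X 1} := by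
  refine le_antisymm (fun f hf => ?_) ?_
  · rw [mem_maximalIdeal_iff_constantCoeff_eq_zero] at hf
    let f₀ : MvPowerSeries (Fin 2) k := fun d => if d 0 = 0 then coeff d f else 0
    have hf₀ d : coeff d f₀ = if d 0 = 0 then coeff d f else 0 := rfl
    obtain ⟨g, hg⟩ : X 0 ∣ f - f₀ := X_dvd_iff.2 fun d hd => by simp [hf₀, hd]
    obtain ⟨h, hh⟩ : X 1 ∣ f₀ := X_dvd_iff.2 fun d hd => by
      rw [hf₀, ite_eq_right_iff]
      intro hd0
      obtain rfl : d = 0 := by ext s; fin_cases s <;> assumption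
      exact hf
    refine Ideal.mem_span_pair.2 ⟨g, h, ?_⟩
    rw [mul_comm g, mul_comm h, ← hg, ← hh, sub_add_cancel]
  · rw [Ideal.span_le, Set.insert_subset_iff, Set.singleton_subset_iff]
    constructor <;> exact mem_maximalIdeal_iff_constantCoeff_eq_zero.2 (constantCoeff_X _)

end PowerSeries

/-! ### The grading by weights -/

section Weights

variable {σ Γ : Type*} [AddCommGroup Γ] (k : Type*) [Field k] (w : σ → Γ)

variable {k w} in
theorem weight_eq_add_of_coeff_mul_ne_zero {f g : MvPowerSeries σ k} {χ ψ : Γ}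
    (hf : ∀ d, coeff d f ≠ 0 → Finsupp.weight w d = χ)
    (hg : ∀ d, coeff d g ≠ 0 → Finsupp.weight w d = ψ) {d : σ →₀ ℕ} (hd : coeff d (f * g) ≠ 0) :
    Finsupp.weight w d = χ + ψ := by
  classical
  rw [coeff_mul] at hd
  obtain ⟨p, hp, hne⟩ := Finset.exists_ne_zero_of_sum_ne_zero hd
  rw [← Finset.HasAntidiagonal.mem_antidiagonal.1 hp, map_add, hf _ (left_ne_zero_of_mul hne),
    hg _ (right_ne_zero_of_mul hne)]

/-- The ring of the power series all of whose monomials have weight zero: the invariants of the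
diagonal action with weights `w` of the Cartier dual of `Γ`. -/
def weightRing : Subalgebra k (MvPowerSeries σ k) where
  carrier := {f | ∀ d, coeff d f ≠ 0 → Finsupp.weight w d = 0}
  mul_mem' hf hg d hd := by rw [weight_eq_add_of_coeff_mul_ne_zero hf hg hd, add_zero]
  add_mem' {f g} hf hg d hd := by
    by_contra h
    exact hd (by rw [map_add, not_not.1 (mt (hf d) h), not_not.1 (mt (hg d) h), add_zero])
  algebraMap_mem' r d hd := by
    classical
    rw [MvPowerSeries.algebraMap_apply, Algebra.algebraMap_self, RingHom.id_apply, coeff_C] at hd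
    obtain rfl : d = 0 := by by_contra h; simp [h] at hd
    exact map_zero _

/-- The power series all of whose monomials have weight `χ`, as a module over those of weight
zero. -/
def weightPart (χ : Γ) : Submodule (weightRing k w) (MvPowerSeries σ k) where
  carrier := {f | ∀ d, coeff d f ≠ 0 → Finsupp.weight w d = χ}
  zero_mem' d hd := absurd (map_zero _) hd
  add_mem' {f g} hf hg d hd := by
    by_contra h
    exact hd (by rw [map_add, not_not.1 (mt (hf d) h), not_not.1 (mt (hg d) h), add_zero])
  smul_mem' r f hf d hd := by rw [weight_eq_add_of_coeff_mul_ne_zero r.2 hf hd, zero_add]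

/-- The projection of a power series onto its part of weight `χ`. -/
def weightProj (χ : Γ) : MvPowerSeries σ k →+ MvPowerSeries σ k where
  toFun f := Set.indicator {d | Finsupp.weight w d = χ} f
  map_zero' := Set.indicator_zero' _
  map_add' f g := Set.indicator_add' _ f g

variable {k w} {χ ψ : Γ} {f g : MvPowerSeries σ k}

theorem mul_mem_weightPart (hf : f ∈ weightPart k w χ) (hg : g ∈ weightPart k w ψ) :
    f * g ∈ weightPart k w (χ + ψ) :=
  fun _ => weight_eq_add_of_coeff_mul_ne_zero hf hg

theorem one_mem_weightPart : (1 : MvPowerSeries σ k) ∈ weightPart k w 0 :=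
  one_mem (weightRing k w)

theorem prod_mem_weightPart {ι : Type*} (s : Finset ι) {χ : ι → Γ} {f : ι → MvPowerSeries σ k}
    (hf : ∀ i ∈ s, f i ∈ weightPart k w (χ i)) :
    ∏ i ∈ s, f i ∈ weightPart k w (∑ i ∈ s, χ i) := by
  classical
  induction s using Finset.induction_on with
  | empty => exact one_mem_weightPart
  | insert i s hi ih =>
    rw [Finset.prod_insert hi, Finset.sum_insert hi]
    exact mul_mem_weightPart (hf i (s.mem_insert_self i))
      (ih fun j hj => hf j (Finset.mem_insert_of_mem hj))

theorem pow_mem_weightPart (hf : f ∈ weightPart k w χ) (i : ℕ) :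
    f ^ i ∈ weightPart k w (i • χ) := by
  simpa using prod_mem_weightPart (Finset.range i) (fun _ _ => hf)

theorem X_mem_weightPart (s : σ) : (X s : MvPowerSeries σ k) ∈ weightPart k w (w s) := by
  classical
  intro d hd
  obtain rfl : d = Finsupp.single s 1 := by by_contra h; simp [coeff_X, h] at hd
  simp [Finsupp.weight_single]

theorem exists_X_pow_mem_weightPart [Finite Γ] {s : σ} (hw : AddSubgroup.zmultiples (w s) = ⊤)
    (χ : Γ) : ∃ i, (X s : MvPowerSeries σ k) ^ i ∈ weightPart k w χ := by
  obtain ⟨i, rfl⟩ := (mem_multiples_iff_mem_zmultiples (x := w s)).2 (hw.ge (AddSubgroup.mem_top χ))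
  exact ⟨i, pow_mem_weightPart (X_mem_weightPart s) i⟩

theorem X_pow_card_mem_weightRing (s : σ) :
    (X s : MvPowerSeries σ k) ^ Nat.card Γ ∈ weightRing k w := by
  have h := pow_mem_weightPart (X_mem_weightPart (k := k) (w := w) s) (Nat.card Γ)
  rwa [card_nsmul_eq_zero'] at h

theorem mem_weightPart_of_X_pow_mul_mem {s : σ} {i : ℕ}
    (hs : X s ^ i ∈ weightPart k w χ) (h : X s ^ i * g ∈ weightPart k w (χ + ψ)) :
    g ∈ weightPart k w ψ := by
  classical
  intro d hd
  have hχ : Finsupp.weight w (Finsupp.single s i) = χ := hs _ (by rw [X_pow_eq]; simp)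
  have hd := h (Finsupp.single s i + d) (by rwa [X_pow_eq, coeff_add_monomial_mul, one_mul])
  rw [map_add, hχ] at hd
  exact add_left_cancel hd

theorem constantCoeff_eq_zero_of_mem_weightPart (hχ : χ ≠ 0) (hf : f ∈ weightPart k w χ) :
    constantCoeff f = 0 := by
  by_contra h
  exact hχ (by simpa using (hf 0 (by simpa using h)).symm)

open scoped Classical in
theorem coeff_weightProj (χ : Γ) (f : MvPowerSeries σ k) (d : σ →₀ ℕ) :
    coeff d (weightProj k w χ f) = if Finsupp.weight w d = χ then coeff d f else 0 :=
  Set.indicator_apply _ f d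

theorem weightProj_mem (χ : Γ) (f : MvPowerSeries σ k) :
    weightProj k w χ f ∈ weightPart k w χ := by
  classical
  intro d hd
  by_contra h
  simp [coeff_weightProj, h] at hd

theorem weightProj_of_mem (hf : f ∈ weightPart k w χ) : weightProj k w χ f = f := by
  classical
  ext d
  rw [coeff_weightProj, ite_eq_left_iff]
  exact fun h => (not_not.1 (mt (hf d) h)).symm

theorem weightProj_of_mem_of_ne (hne : χ ≠ ψ) (hf : f ∈ weightPart k w ψ) :
    weightProj k w χ f = 0 := by
  classical
  ext d
  rw [coeff_weightProj, map_zero, ite_eq_right_iff]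
  exact fun h => not_not.1 (mt (hf d) (h ▸ hne))

theorem sum_weightProj [Fintype Γ] (f : MvPowerSeries σ k) : ∑ χ, weightProj k w χ f = f := by
  classical
  ext d
  simp [coeff_weightProj]

theorem weightProj_mul (hf : f ∈ weightPart k w χ) (ψ : Γ) (g : MvPowerSeries σ k) :
    weightProj k w (χ + ψ) (f * g) = f * weightProj k w ψ g := by
  classical
  ext d
  have coeff_mul_coeff p (hp : p ∈ Finset.HasAntidiagonal.antidiagonal d) :
      coeff p.1 f * coeff p.2 (weightProj k w ψ g) =
        if Finsupp.weight w d = χ + ψ then coeff p.1 f * coeff p.2 g else 0 := by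
    rw [coeff_weightProj, ← Finset.HasAntidiagonal.mem_antidiagonal.1 hp, map_add]
    by_cases h : coeff p.1 f = 0
    · simp [h]
    · simp [hf _ h]
  rw [coeff_weightProj, coeff_mul, coeff_mul, Finset.sum_congr rfl coeff_mul_coeff]
  split_ifs <;> simp

end Weights

/-! ### Graded modules -/

section GradedModules

variable {σ Γ : Type*} [AddCommGroup Γ] [Fintype Γ] (k : Type*) [Field k] (w : σ → Γ)

/-- A grading of a module over the ring of power series that is compatible with the grading by
weights. It is encoded by the projections onto the homogeneous parts. -/
structure WeightGrading (N : Type*) [AddCommGroup N] [Module (MvPowerSeries σ k) N] where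
  /-- The projection onto the elements of degree `χ`. -/
  proj (χ : Γ) : N →+ N
  sum_proj (x : N) : ∑ χ, proj χ x = x
  proj_proj (χ : Γ) (x : N) : proj χ (proj χ x) = proj χ x
  proj_proj_of_ne {χ ψ : Γ} (h : χ ≠ ψ) (x : N) : proj χ (proj ψ x) = 0
  proj_smul {χ : Γ} {f : MvPowerSeries σ k} (hf : f ∈ weightPart k w χ) (ψ : Γ) (x : N) :
    proj (χ + ψ) (f • x) = f • proj ψ x

namespace WeightGrading

variable {k w} {N : Type*} [AddCommGroup N] [Module (MvPowerSeries σ k) N]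
  (𝒢 : WeightGrading k w N)

theorem proj_smul_of_proj_eq {χ : Γ} {e : N} (he : 𝒢.proj χ e = e) (ψ : Γ)
    (f : MvPowerSeries σ k) : 𝒢.proj ψ (f • e) = weightProj k w (ψ - χ) f • e := by
  conv_lhs => rw [← sum_weightProj (w := w) f, Finset.sum_smul, map_sum]
  rw [Finset.sum_eq_single_of_mem (ψ - χ) (Finset.mem_univ _)]
  · have := 𝒢.proj_smul (weightProj_mem (ψ - χ) f) χ e
    rwa [sub_add_cancel, he] at this
  · intro φ _ hφ
    have := 𝒢.proj_smul (weightProj_mem φ f) (ψ - φ) e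
    rw [add_sub_cancel] at this
    rw [this, ← he, 𝒢.proj_proj_of_ne fun h => hφ (by rw [← h, sub_sub_cancel]), smul_zero]

theorem exists_homogeneous_generators [Module.Finite (MvPowerSeries σ k) N] :
    ∃ (s : Finset N), Submodule.span (MvPowerSeries σ k) (s : Set N) = ⊤ ∧
      ∀ x ∈ s, ∃ χ, 𝒢.proj χ x = x := by
  classical
  obtain ⟨s, hs⟩ := Module.Finite.fg_top (R := MvPowerSeries σ k) (M := N)
  refine ⟨Finset.image₂ (fun x χ => 𝒢.proj χ x) s Finset.univ, ?_, ?_⟩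
  · rw [eq_top_iff, ← hs, Submodule.span_le]
    intro x hx
    rw [← 𝒢.sum_proj x]
    exact sum_mem fun χ _ => Submodule.subset_span
      (Finset.mem_image₂_of_mem hx (Finset.mem_univ χ))
  · intro y hy
    obtain ⟨x, -, χ, -, rfl⟩ := Finset.mem_image₂.1 hy
    exact ⟨χ, 𝒢.proj_proj χ x⟩

theorem exists_homogeneous_generators_forall_relation_mem_maximalIdeal
    [Module.Finite (MvPowerSeries σ k) N] :
    ∃ s : Finset N, Submodule.span (MvPowerSeries σ k) (s : Set N) = ⊤ ∧
      (∀ x ∈ s, ∃ χ, 𝒢.proj χ x = x) ∧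
      ∀ c : s → MvPowerSeries σ k, ∑ x, c x • (x : N) = 0 →
        ∀ x, c x ∈ maximalIdeal (MvPowerSeries σ k) := by
  classical
  obtain ⟨s, ⟨hspan, hs⟩, hmin⟩ := wellFounded_lt.has_min _ 𝒢.exists_homogeneous_generators
  refine ⟨s, hspan, hs, fun c hc x => ?_⟩
  rw [mem_maximalIdeal, mem_nonunits_iff]
  intro hx
  have hspan' := span_compl_singleton_eq_top_of_isUnit (e := ((↑) : s → N)) (by simpa) hc hx
  refine hmin (s.erase x) ⟨eq_top_iff.2 (hspan' ▸ Submodule.span_mono ?_),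
    fun y hy => hs y (Finset.mem_of_mem_erase hy)⟩ (Finset.erase_ssubset x.2)
  rintro _ ⟨y, hy, rfl⟩
  exact Finset.mem_erase.2 ⟨mt Subtype.ext hy, y.2⟩

theorem exists_homogeneous_basis {w : Fin 2 → Γ} {N : Type*} [AddCommGroup N]
    [Module (MvPowerSeries (Fin 2) k) N] [Module.Finite (MvPowerSeries (Fin 2) k) N]
    (𝒢 : WeightGrading k w N)
    (hN : IsKoszulExact N (X 0 : MvPowerSeries (Fin 2) k) (X 1)) :
    ∃ (r : ℕ) (e : Module.Basis (Fin r) (MvPowerSeries (Fin 2) k) N) (χ : Fin r → Γ),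
      ∀ t, 𝒢.proj (χ t) (e t) = e t := by
  obtain ⟨s, hspan, hs, hmin⟩ := 𝒢.exists_homogeneous_generators_forall_relation_mem_maximalIdeal
  have hspan : Submodule.span (MvPowerSeries (Fin 2) k) (Set.range ((↑) : s → N)) = ⊤ := by
    simpa
  choose χ hχ using fun x : s => hs x x.2
  let e := Module.Basis.mk
    (linearIndependent_of_relations_mem_maximalIdeal maximalIdeal_eq_span_X_pair hN hspan hmin)
    hspan.ge
  exact ⟨_, e.reindex s.equivFin, χ ∘ s.equivFin.symm, fun t => by simp [e, hχ]⟩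

/-- The elements of degree zero. -/
def zeroPart : Submodule (weightRing k w) N where
  carrier := {x | 𝒢.proj 0 x = x}
  zero_mem' := map_zero _
  add_mem' {x y} hx hy := by
    rw [Set.mem_ofPred_eq] at *
    rw [map_add, hx, hy]
  smul_mem' r x hx := by
    rw [Set.mem_ofPred_eq] at *
    have := 𝒢.proj_smul r.2 0 x
    rwa [hx, zero_add] at this

theorem mem_zeroPart {x : N} : x ∈ 𝒢.zeroPart ↔ 𝒢.proj 0 x = x := Iff.rfl

theorem sum_weightProj_repr_smul {ι : Type*} [Fintype ι]
    (e : Module.Basis ι (MvPowerSeries σ k) N) {χ : ι → Γ}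
    (he : ∀ t, 𝒢.proj (χ t) (e t) = e t) {ψ : Γ} {z : N} (hz : 𝒢.proj ψ z = z) :
    ∑ t, weightProj k w (ψ - χ t) (e.repr z t) • e t = z := by
  conv_rhs => rw [← hz, ← e.sum_repr z, map_sum]
  exact Finset.sum_congr rfl fun t _ => (𝒢.proj_smul_of_proj_eq (he t) ψ _).symm

theorem exists_degree_eq_of_notMem_maximalIdeal_smul_top {ι : Type*} [Finite ι]
    (e : Module.Basis ι (MvPowerSeries σ k) N) {χ : ι → Γ}
    (he : ∀ t, 𝒢.proj (χ t) (e t) = e t) {ψ : Γ} {z : N} (hz : 𝒢.proj ψ z = z)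
    (hmin : z ∉ maximalIdeal (MvPowerSeries σ k) • (⊤ : Submodule (MvPowerSeries σ k) N)) :
    ∃ t, χ t = ψ := by
  cases nonempty_fintype ι
  by_contra! h
  rw [← 𝒢.sum_weightProj_repr_smul e he hz] at hmin
  exact hmin (sum_mem fun t _ => Submodule.smul_mem_smul
    (mem_maximalIdeal_iff_constantCoeff_eq_zero.2 (constantCoeff_eq_zero_of_mem_weightPart
      (sub_ne_zero.2 (h t).symm) (weightProj_mem _ _))) Submodule.mem_top)

/-- The degree zero part of a free module with a homogeneous basis is the direct sum of parts of
the ring of power series. -/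
def zeroPartEquiv {ι : Type*} [Fintype ι] (e : Module.Basis ι (MvPowerSeries σ k) N) {χ : ι → Γ}
    (he : ∀ t, 𝒢.proj (χ t) (e t) = e t) :
    (∀ t, weightPart k w (-χ t)) ≃ₗ[weightRing k w] 𝒢.zeroPart :=
  LinearEquiv.ofBijective
    (((Fintype.linearCombination (MvPowerSeries σ k) e).restrictScalars (weightRing k w) ∘ₗ
      LinearMap.pi fun t => (weightPart k w (-χ t)).subtype ∘ₗ LinearMap.proj t).codRestrict
        𝒢.zeroPart fun s => by
      rw [mem_zeroPart]
      simp only [LinearMap.comp_apply, LinearMap.restrictScalars_apply,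
        Fintype.linearCombination_apply, map_sum]
      refine Finset.sum_congr rfl fun t _ => ?_
      rw [𝒢.proj_smul_of_proj_eq (he t), zero_sub]
      exact congrArg (· • e t) (weightProj_of_mem (s t).2)) <| by
    constructor
    · intro s s' h
      have h := congrArg Subtype.val h
      funext t
      exact Subtype.ext (congrFun (e.linearIndependent.fintypeLinearCombination_injective h) t)
    · rintro ⟨x, hx⟩
      refine ⟨fun t => ⟨weightProj k w (-χ t) (e.repr x t), weightProj_mem _ _⟩, Subtype.ext ?_⟩
      simpa [Fintype.linearCombination_apply] using 𝒢.sum_weightProj_repr_smul e he hx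

end WeightGrading

end GradedModules

/-! ### The ring of power series of weight zero -/

section WeightRing

variable {σ Γ k : Type*} [AddCommGroup Γ] [Field k] {w : σ → Γ} {χ : Γ}

theorem weightProj_mem_of_mem_span {P : Submodule (weightRing k w) (MvPowerSeries σ k)}
    (hP : P ≤ weightPart k w χ) {f : MvPowerSeries σ k}
    (hf : f ∈ Submodule.span (MvPowerSeries σ k) (P : Set (MvPowerSeries σ k))) :
    weightProj k w χ f ∈ P := by
  suffices h : ∀ g, weightProj k w χ (g * f) ∈ P by simpa using h 1
  induction hf using Submodule.span_induction with
  | mem f hf =>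
    intro g
    have h := weightProj_mul (hP hf) 0 g
    rw [add_zero, mul_comm f, mul_comm f] at h
    rw [h]
    exact P.smul_mem ⟨_, weightProj_mem 0 g⟩ hf
  | zero => simp
  | add f f' _ _ hf hf' =>
    intro g
    rw [mul_add, map_add]
    exact add_mem (hf g) (hf' g)
  | smul c f _ hf =>
    intro g
    rw [smul_eq_mul, ← mul_assoc]
    exact hf _

instance isNoetherian_weightPart [Finite σ] :
    IsNoetherian (weightRing k w) (weightPart k w χ) :=
  isNoetherian_submodule.2 fun P hP => by
    obtain ⟨t, htP, ht⟩ := (Submodule.fg_span_iff_fg_span_finset_subset _).1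
      (IsNoetherian.noetherian (Submodule.span (MvPowerSeries σ k) (P : Set (MvPowerSeries σ k))))
    have hle := Submodule.span_le.2 htP
    refine ⟨t, le_antisymm hle fun f hf => ?_⟩
    rw [← weightProj_of_mem (hP hf)]
    refine weightProj_mem_of_mem_span (hle.trans hP) (Submodule.span_mono Submodule.subset_span ?_)
    exact ht.le (Submodule.subset_span hf)

variable (k w) in
/-- The part of weight zero is the base ring. -/
def weightPartZeroEquiv : weightPart k w 0 ≃ₗ[weightRing k w] weightRing k w where
  toFun f := ⟨f, f.2⟩
  invFun r := ⟨r, r.2⟩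
  map_add' _ _ := rfl
  map_smul' _ _ := rfl

instance isNoetherianRing_weightRing [Finite σ] : IsNoetherianRing (weightRing k w) :=
  isNoetherian_of_linearEquiv (weightPartZeroEquiv k w)

instance finite_mvPowerSeries [Finite σ] [Finite Γ] :
    Module.Finite (weightRing k w) (MvPowerSeries σ k) := by
  cases nonempty_fintype Γ
  refine Module.Finite.of_surjective
    (∑ χ, (weightPart k w χ).subtype ∘ₗ LinearMap.proj χ :
      (∀ χ, weightPart k w χ) →ₗ[weightRing k w] MvPowerSeries σ k) fun f =>
    ⟨fun χ => ⟨weightProj k w χ f, weightProj_mem χ f⟩, ?_⟩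
  simpa using sum_weightProj f

theorem isUnit_weightRing_iff {r : weightRing k w} :
    IsUnit r ↔ constantCoeff (r : MvPowerSeries σ k) ≠ 0 := by
  rw [← isUnit_iff_constantCoeff_ne_zero]
  refine ⟨fun h => h.map (algebraMap (weightRing k w) (MvPowerSeries σ k)), fun h => ?_⟩
  obtain ⟨g, hg⟩ := h.exists_right_inv
  refine IsUnit.of_mul_eq_one ⟨weightProj k w 0 g, weightProj_mem 0 g⟩ (Subtype.ext ?_)
  have h := weightProj_mul r.2 0 g
  rwa [hg, zero_add, weightProj_of_mem one_mem_weightPart, eq_comm] at h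

instance isLocalRing_weightRing : IsLocalRing (weightRing k w) :=
  .of_nonunits_add fun r s hr hs => by
    rw [mem_nonunits_iff, isUnit_weightRing_iff, not_not] at *
    rw [AddMemClass.coe_add, map_add, hr, hs, add_zero]

theorem mem_maximalIdeal_weightRing_iff {r : weightRing k w} :
    r ∈ maximalIdeal (weightRing k w) ↔ constantCoeff (r : MvPowerSeries σ k) = 0 := by
  rw [mem_maximalIdeal, mem_nonunits_iff, isUnit_weightRing_iff, not_not]

theorem isWeaklyRegular_weightRing {x y : weightRing k w}
    (h : IsWeaklyRegular (MvPowerSeries σ k) [(x : MvPowerSeries σ k), (y : MvPowerSeries σ k)]) :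
    IsWeaklyRegular (weightRing k w) [x, y] := by
  obtain ⟨hx, hxy⟩ := isWeaklyRegular_pair_iff.1 h
  refine isWeaklyRegular_pair_iff.2
    ⟨fun z hz => Subtype.ext (hx z (congrArg Subtype.val hz)), fun z s hzs => ?_⟩
  obtain ⟨t, ht⟩ := hxy z s (congrArg Subtype.val hzs)
  refine ⟨⟨weightProj k w 0 t, weightProj_mem 0 t⟩, Subtype.ext ?_⟩
  have h := weightProj_mul x.2 0 t
  rwa [zero_add, ← smul_eq_mul, ← ht, weightProj_of_mem z.2] at h

theorem ringKrullDim_weightRing [Finite Γ] (w : Fin 2 → Γ) : ringKrullDim (weightRing k w) = 2 := by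
  let x (s : Fin 2) : weightRing k w := ⟨X s ^ Nat.card Γ, X_pow_card_mem_weightRing s⟩
  have hx s : x s ∈ maximalIdeal (weightRing k w) := by
    rw [mem_maximalIdeal_weightRing_iff, map_pow, constantCoeff_X, zero_pow Nat.card_pos.ne']
  refine ringKrullDim_eq_two_of_isWeaklyRegular (hx 0) (hx 1)
    (isWeaklyRegular_weightRing (isWeaklyRegular_X_pow_X_pow (by decide) _ _))
    fun f hf => ⟨Nat.card Γ + Nat.card Γ, ?_⟩
  rw [mem_maximalIdeal_weightRing_iff, ← mem_maximalIdeal_iff_constantCoeff_eq_zero,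
    maximalIdeal_eq_span_X_pair] at hf
  obtain ⟨g, h, hgh⟩ := Ideal.mem_span_pair.1 hf
  have hpow : (f : MvPowerSeries (Fin 2) k) ^ (Nat.card Γ + Nat.card Γ) ∈
      Ideal.span {(x 0 : MvPowerSeries (Fin 2) k), (x 1 : MvPowerSeries (Fin 2) k)} := by
    rw [← hgh]
    refine Ideal.add_pow_mem_of_pow_mem_of_le _ (m := Nat.card Γ) (n := Nat.card Γ) ?_ ?_
      (Nat.le_succ _) <;> rw [mul_pow]
    · exact Ideal.mul_mem_left _ _ (Ideal.subset_span (.inl rfl))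
    · exact Ideal.mul_mem_left _ _ (Ideal.subset_span (.inr rfl))
  obtain ⟨p, q, hpq⟩ := Ideal.mem_span_pair.1 hpow
  refine Ideal.mem_span_pair.2 ⟨⟨weightProj k w 0 p, weightProj_mem 0 p⟩,
    ⟨weightProj k w 0 q, weightProj_mem 0 q⟩, Subtype.ext ?_⟩
  have hp := weightProj_mul (x 0).2 0 p
  have hq := weightProj_mul (x 1).2 0 q
  rw [zero_add] at hp hq
  change weightProj k w 0 p * (x 0 : MvPowerSeries (Fin 2) k) +
    weightProj k w 0 q * (x 1 : MvPowerSeries (Fin 2) k) = f ^ _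
  rw [mul_comm, ← hp, mul_comm (weightProj k w 0 q), ← hq, ← map_add, mul_comm _ p,
    mul_comm _ q, hpq]
  exact weightProj_of_mem (f ^ (Nat.card Γ + Nat.card Γ)).2

end WeightRing

/-! ### Homomorphisms between the parts of given weight -/

section WeightPartHoms

variable {σ Γ k : Type*} [AddCommGroup Γ] [Finite Γ] [Field k] {w : σ → Γ}

theorem exists_injective_weightPart {s : σ} (hw : AddSubgroup.zmultiples (w s) = ⊤) (χ ψ : Γ) :
    ∃ φ : weightPart k w χ →ₗ[weightRing k w] weightPart k w ψ, Function.Injective φ := by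
  obtain ⟨i, hi⟩ := exists_X_pow_mem_weightPart (k := k) hw (ψ - χ)
  refine ⟨LinearMap.codRestrict _ ((LinearMap.mulLeft _ (X s ^ i)).domRestrict _) fun f => ?_,
    fun f g h => Subtype.ext
      (mul_left_cancel₀ (pow_ne_zero i (X_ne_zero s)) (congrArg Subtype.val h))⟩
  have := mul_mem_weightPart hi f.2
  rwa [sub_add_cancel] at this

theorem mul_map_comm {χ : Γ}
    (φ : weightPart k w χ →ₗ[weightRing k w] MvPowerSeries σ k) (f g : weightPart k w χ) :
    (f : MvPowerSeries σ k) * φ g = g * φ f := by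
  rcases eq_or_ne f 0 with rfl | hf
  · simp
  obtain ⟨m, hm⟩ := Nat.exists_eq_add_one.2 (Nat.card_pos (α := Γ))
  have pow_mul_mem {h : MvPowerSeries σ k} (hh : h ∈ weightPart k w χ) :
      (f : MvPowerSeries σ k) ^ m * h ∈ weightRing k w := by
    have := mul_mem_weightPart (pow_mem_weightPart f.2 m) hh
    rwa [← succ_nsmul, ← hm, card_nsmul_eq_zero'] at this
  let c : weightRing k w := ⟨f ^ m * g, pow_mul_mem g.2⟩
  let d : weightRing k w := ⟨f ^ m * f, pow_mul_mem f.2⟩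
  have h : c • f = d • g :=
    Subtype.ext (mul_right_comm ((f : MvPowerSeries σ k) ^ m) g f)
  have h : (f : MvPowerSeries σ k) ^ m * g * φ f = f ^ m * f * φ g :=
    (φ.map_smul c f).symm.trans ((congrArg φ h).trans (φ.map_smul d g))
  apply mul_left_cancel₀ (pow_ne_zero m ((weightPart k w χ).coe_eq_zero.not.2 hf))
  linear_combination -h

theorem multilinearMap_mul_prod_eq {ι : Type*} [DecidableEq ι] {χ : ι → Γ}
    (φ : MultilinearMap (weightRing k w) (fun i => weightPart k w (χ i)) (MvPowerSeries σ k))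
    (f g : ∀ i, weightPart k w (χ i)) (A : Finset ι) :
    φ f * ∏ i ∈ A, (g i : MvPowerSeries σ k) =
      φ (A.piecewise g f) * ∏ i ∈ A, (f i : MvPowerSeries σ k) := by
  induction A using Finset.induction_on with
  | empty => simp
  | insert i A hi ih =>
    have h := mul_map_comm (φ.toLinearMap (A.piecewise g f) i) (f i) (g i)
    have hf : Function.update (A.piecewise g f) i (f i) = A.piecewise g f := by
      rw [Function.update_eq_self_iff, Finset.piecewise_eq_of_notMem _ _ _ hi]
    rw [MultilinearMap.toLinearMap_apply, MultilinearMap.toLinearMap_apply, hf] at h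
    rw [Finset.prod_insert hi, Finset.prod_insert hi, Finset.piecewise_insert]
    linear_combination (g i : MvPowerSeries σ k) * ih -
      (∏ i ∈ A, (f i : MvPowerSeries σ k)) * h

variable {ι : Type*} [Fintype ι]

/- The quotient of the values of a multilinear map by the products of the arguments has a power of
`X s` as well as a power of `X t` as denominator, and these are coprime. -/
theorem exists_multilinearMap_eq_prod_mul [Nontrivial σ]
    (hw : ∀ s, AddSubgroup.zmultiples (w s) = ⊤) {χ : ι → Γ}
    (φ : MultilinearMap (weightRing k w) (fun i => weightPart k w (χ i)) (MvPowerSeries σ k)) :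
    ∃ h : MvPowerSeries σ k, ∀ f, φ f = (∏ i, (f i : MvPowerSeries σ k)) * h := by
  classical
  obtain ⟨s, t, hst⟩ := exists_pair_ne σ
  choose p hp using fun i => exists_X_pow_mem_weightPart (k := k) (hw s) (χ i)
  choose q hq using fun i => exists_X_pow_mem_weightPart (k := k) (hw t) (χ i)
  let U (i) : weightPart k w (χ i) := ⟨_, hp i⟩
  let V (i) : weightPart k w (χ i) := ⟨_, hq i⟩
  have mul_X_pow_eq f : φ f * X s ^ (∑ i, p i) = φ U * ∏ i, (f i : MvPowerSeries σ k) := by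
    have := multilinearMap_mul_prod_eq φ f U Finset.univ
    rwa [Finset.piecewise_univ, Finset.prod_pow_eq_pow_sum] at this
  obtain ⟨h, hh⟩ : X s ^ (∑ i, p i) ∣ φ U := by
    refine X_pow_dvd_of_dvd_X_pow_mul hst (j := ∑ i, q i) ⟨φ V, ?_⟩
    rw [mul_comm _ (φ V), mul_X_pow_eq, Finset.prod_pow_eq_pow_sum, mul_comm]
  refine ⟨h, fun f => mul_right_cancel₀ (pow_ne_zero (∑ i, p i) (X_ne_zero s)) ?_⟩
  rw [mul_X_pow_eq, hh]
  ring

theorem exists_linearMap_eq_mul [Nontrivial σ] (hw : ∀ s, AddSubgroup.zmultiples (w s) = ⊤) {χ : Γ}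
    (φ : weightPart k w χ →ₗ[weightRing k w] MvPowerSeries σ k) :
    ∃ h : MvPowerSeries σ k, ∀ f, φ f = f * h := by
  obtain ⟨h, hh⟩ := exists_multilinearMap_eq_prod_mul hw
    (φ.compMultilinearMap (MultilinearMap.ofSubsingleton _ _ _ (0 : Fin 1) LinearMap.id))
  exact ⟨h, fun f => by simpa using hh fun _ => f⟩

theorem mem_weightPart_of_forall_prod_mul_mem {s : σ} (hw : AddSubgroup.zmultiples (w s) = ⊤)
    {χ : ι → Γ} {ψ : Γ} {h : MvPowerSeries σ k}
    (hh : ∀ f : ∀ i, weightPart k w (χ i),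
      (∏ i, (f i : MvPowerSeries σ k)) * h ∈ weightPart k w (∑ i, χ i + ψ)) :
    h ∈ weightPart k w ψ := by
  choose p hp using fun i => exists_X_pow_mem_weightPart (k := k) hw (χ i)
  have h1 := hh fun i => ⟨_, hp i⟩
  have h2 := prod_mem_weightPart Finset.univ fun i _ => hp i
  simp only [Finset.prod_pow_eq_pow_sum] at h1 h2
  exact mem_weightPart_of_X_pow_mul_mem h2 h1

theorem eq_of_forall_prod_mul_eq {s : σ} (hw : AddSubgroup.zmultiples (w s) = ⊤) (χ : ι → Γ)
    {h h' : MvPowerSeries σ k}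
    (hh : ∀ f : ∀ i, weightPart k w (χ i), (∏ i, (f i : MvPowerSeries σ k)) * h =
      (∏ i, (f i : MvPowerSeries σ k)) * h') : h = h' := by
  choose p hp using fun i => exists_X_pow_mem_weightPart (k := k) hw (χ i)
  have h1 := hh fun i => ⟨_, hp i⟩
  simp only [Finset.prod_pow_eq_pow_sum] at h1
  exact mul_left_cancel₀ (pow_ne_zero _ (X_ne_zero s)) h1

end WeightPartHoms

/-! ### Coinduced modules -/

section Retracts

variable {R M P : Type*} [CommRing R] [AddCommGroup M] [Module R M] [AddCommGroup P] [Module R P]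

theorem isCompl_range_ker_of_comp_eq_id {f : M →ₗ[R] P} {g : P →ₗ[R] M}
    (h : f ∘ₗ g = LinearMap.id) : IsCompl (LinearMap.range g) (LinearMap.ker f) := by
  have hfg : Function.LeftInverse f g := LinearMap.congr_fun h
  have hidem : IsIdempotentElem (g ∘ₗ f) :=
    LinearMap.ext fun x => congrArg g (hfg (f x))
  have := LinearMap.IsIdempotentElem.isCompl hidem
  rwa [LinearMap.range_comp_of_range_eq_top _ (LinearMap.range_eq_top.2 hfg.surjective),
    LinearMap.ker_comp_of_ker_eq_bot _ (LinearMap.ker_eq_bot.2 hfg.injective)] at this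

theorem IsIndecomposable.exists_equiv_of_comp_eq_id [Nontrivial P] (hM : IsIndecomposable R M)
    {f : M →ₗ[R] P} {g : P →ₗ[R] M} (h : f ∘ₗ g = LinearMap.id) : Nonempty (M ≃ₗ[R] P) := by
  have hfg : Function.LeftInverse f g := LinearMap.congr_fun h
  have hker : LinearMap.ker f = ⊥ :=
    (hM.2 _ _ (isCompl_range_ker_of_comp_eq_id h)).resolve_left fun hg =>
      not_subsingleton P ⟨fun x y => hfg.injective (by rw [LinearMap.range_eq_bot.1 hg]; rfl)⟩
  exact ⟨LinearEquiv.ofBijective f ⟨LinearMap.ker_eq_bot.1 hker, hfg.surjective⟩⟩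

end Retracts

section Coinduced

variable (A S M : Type*) [CommRing A] [CommRing S] [Algebra A S] [AddCommGroup M] [Module A M]

/-- The module `Hom_A(S, M)` over the `A`-algebra `S`. It is a synonym of `S →ₗ[A] M`, on which
Mathlib has no action of `S` through the argument. -/
def Coinduced : Type _ := S →ₗ[A] M

namespace Coinduced

instance : AddCommGroup (Coinduced A S M) := inferInstanceAs (AddCommGroup (S →ₗ[A] M))

instance : FunLike (Coinduced A S M) S M := inferInstanceAs (FunLike (S →ₗ[A] M) S M)

instance : LinearMapClass (Coinduced A S M) A S M :=
  inferInstanceAs (LinearMapClass (S →ₗ[A] M) A S M)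

variable {A S M}

/-- A linear map, as an element of the coinduced module. -/
def of (φ : S →ₗ[A] M) : Coinduced A S M := φ

@[ext]
theorem ext {φ ψ : Coinduced A S M} (h : ∀ f, φ f = ψ f) : φ = ψ := LinearMap.ext h

theorem add_apply (φ ψ : Coinduced A S M) (f : S) : (φ + ψ) f = φ f + ψ f := rfl

theorem sum_apply {ι : Type*} (s : Finset ι) (φ : ι → Coinduced A S M) (f : S) :
    (∑ i ∈ s, φ i) f = ∑ i ∈ s, φ i f :=
  LinearMap.sum_apply (M := S) s φ f

instance : SMul S (Coinduced A S M) where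
  smul s φ := of ((φ : S →ₗ[A] M) ∘ₗ LinearMap.mulLeft A s)

theorem smul_apply (s : S) (φ : Coinduced A S M) (f : S) : (s • φ) f = φ (s * f) := rfl

instance : Module S (Coinduced A S M) where
  one_smul φ := by ext f; rw [smul_apply, one_mul]
  mul_smul s t φ := by ext f; rw [smul_apply, smul_apply, smul_apply, ← mul_assoc, mul_comm s]
  smul_zero _ := rfl
  smul_add _ _ _ := rfl
  add_smul s t φ := by ext f; simp only [smul_apply, add_apply, add_mul, map_add]
  zero_smul φ := by ext f; rw [smul_apply, zero_mul, map_zero]; rfl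

theorem algebraMap_smul_apply (r : A) (φ : Coinduced A S M) (f : S) :
    (algebraMap A S r • φ) f = r • φ f := by
  rw [smul_apply, ← Algebra.smul_def, map_smul]

instance [IsNoetherianRing A] [Module.Finite A S] [Module.Finite A M] :
    Module.Finite S (Coinduced A S M) := by
  obtain ⟨s, hs⟩ := Module.Finite.fg_top (R := A) (M := S →ₗ[A] M)
  refine ⟨Submodule.fg_def.2 ⟨of '' s, s.finite_toSet.image of, eq_top_iff.2 ?_⟩⟩
  rintro (φ : S →ₗ[A] M) -
  have hφ : φ ∈ Submodule.span A (s : Set (S →ₗ[A] M)) := hs ▸ Submodule.mem_top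
  induction hφ using Submodule.span_induction with
  | mem φ hφ => exact Submodule.subset_span ⟨φ, hφ, rfl⟩
  | zero => exact zero_mem _
  | add φ ψ _ _ hφ hψ => exact add_mem hφ hψ
  | smul r φ _ hφ =>
    have of_smul : of (r • φ) = algebraMap A S r • of φ :=
      ext fun f => (algebraMap_smul_apply r (of φ) f).symm
    change of (r • φ) ∈ _
    rw [of_smul]
    exact Submodule.smul_mem _ _ hφ

theorem isWeaklyRegular_algebraMap {x y : A} (h : IsWeaklyRegular M [x, y]) :
    IsWeaklyRegular (Coinduced A S M) [algebraMap A S x, algebraMap A S y] := by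
  obtain ⟨hx, hxy⟩ := isWeaklyRegular_pair_iff.1 h
  have hinj : Function.Injective fun z : M => x • z := fun z z' hz =>
    sub_eq_zero.1 (hx _ (by rw [smul_sub, sub_eq_zero.2 hz]))
  refine isWeaklyRegular_pair_iff.2 ⟨fun φ hφ => ext fun f => hx _ ?_, fun φ ψ hφψ => ?_⟩
  · rw [← algebraMap_smul_apply, hφ]
    rfl
  have exists_eq f : ∃ t, φ f = x • t := hxy (φ f) (ψ f) (by
    rw [← algebraMap_smul_apply, hφψ, algebraMap_smul_apply])
  choose θ hθ using exists_eq
  let θ' : S →ₗ[A] M :=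
    { toFun := θ
      map_add' f g := hinj <| by simp only [smul_add, ← hθ, map_add]
      map_smul' r f := hinj <| by simp only [RingHom.id_apply, smul_comm x r, ← hθ, map_smul] }
  exact ⟨of θ', ext fun f => (hθ f).trans (algebraMap_smul_apply x (of θ') f).symm⟩

end Coinduced

end Coinduced

section CoinducedGrading

variable {σ Γ : Type*} [AddCommGroup Γ] (k : Type*) [Field k] (w : σ → Γ)

/-- The projection onto the part of weight `χ`, as a linear map over the power series of weight
zero. -/
def weightProjLinear (χ : Γ) : MvPowerSeries σ k →ₗ[weightRing k w] weightPart k w χ where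
  toFun f := ⟨weightProj k w χ f, weightProj_mem χ f⟩
  map_add' f g := Subtype.ext (map_add _ f g)
  map_smul' r f := Subtype.ext (by
    have := weightProj_mul r.2 χ f
    rwa [zero_add] at this)

variable (M : Type*) [AddCommGroup M] [Module (weightRing k w) M]

/-- The grading of `Hom_R(S, M)` induced by the grading of `S = k⟦X⟧`, with signs such that
multiplication by a homogeneous element raises the degree. -/
def Coinduced.grading [Fintype Γ] :
    WeightGrading k w (Coinduced (weightRing k w) (MvPowerSeries σ k) M) where
  proj χ :=
    { toFun φ := of ((φ : MvPowerSeries σ k →ₗ[weightRing k w] M) ∘ₗ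
        (weightPart k w (-χ)).subtype ∘ₗ weightProjLinear k w (-χ))
      map_zero' := rfl
      map_add' _ _ := rfl }
  sum_proj φ := by
    ext f
    rw [Coinduced.sum_apply]
    change ∑ χ, φ (weightProj k w (-χ) f) = φ f
    conv_rhs => rw [← sum_weightProj (w := w) f, ← Equiv.sum_comp (Equiv.neg Γ), map_sum]
    rfl
  proj_proj χ φ := by
    ext f
    exact congrArg φ (weightProj_of_mem (weightProj_mem _ f))
  proj_proj_of_ne h φ := by
    ext f
    exact (congrArg φ (weightProj_of_mem_of_ne (neg_injective.ne h.symm)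
      (weightProj_mem _ f))).trans (map_zero φ)
  proj_smul {χ s} hs ψ φ := by
    ext f
    change φ (s * weightProj k w (-(χ + ψ)) f) = φ (weightProj k w (-ψ) (s * f))
    rw [← weightProj_mul hs, neg_add, add_neg_cancel_left]

/-- The part of degree zero of `Hom_R(S, M)` is `M`. -/
def Coinduced.gradingZeroPartEquiv [Fintype Γ] :
    (Coinduced.grading k w M).zeroPart ≃ₗ[weightRing k w] M where
  toFun φ := (φ : Coinduced (weightRing k w) (MvPowerSeries σ k) M) 1
  map_add' _ _ := rfl
  map_smul' r φ := Coinduced.algebraMap_smul_apply r φ.1 1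
  invFun m := ⟨of (LinearMap.toSpanSingleton (weightRing k w) M m ∘ₗ
    (weightPartZeroEquiv k w).toLinearMap ∘ₗ weightProjLinear k w 0), by
    rw [WeightGrading.mem_zeroPart]
    ext f
    refine congrArg (fun r : weightRing k w => r • m) (Subtype.ext ?_)
    change weightProj k w 0 (weightProj k w (-0) f) = weightProj k w 0 f
    rw [neg_zero, weightProj_of_mem (weightProj_mem _ f)]⟩
  left_inv φ := by
    obtain ⟨φ, hφ⟩ := φ
    refine Subtype.ext (Coinduced.ext fun f => ?_)
    have hf : φ (weightProj k w 0 f) = φ f := by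
      have h := congrArg (fun ψ : Coinduced _ (MvPowerSeries σ k) M => ψ f) hφ
      change φ (weightProj k w (-0) f) = φ f at h
      rwa [neg_zero] at h
    rw [← hf, ← mul_one (weightProj k w 0 f)]
    exact (map_smul φ (⟨_, weightProj_mem 0 f⟩ : weightRing k w) 1).symm
  right_inv m := by
    have h : weightPartZeroEquiv k w (weightProjLinear k w 0 1) = 1 :=
      Subtype.ext (weightProj_of_mem one_mem_weightPart)
    change weightPartZeroEquiv k w (weightProjLinear k w 0 1) • m = m
    rw [h, one_smul]

end CoinducedGrading

/-! ### Maximal Cohen-Macaulay modules -/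

section MaximalCohenMacaulay

variable {σ Γ k M : Type*} [AddCommGroup Γ] [Finite Γ] [Field k] [AddCommGroup M]

theorem exists_equiv_pi_weightPart_of_isWeaklyRegular {w : Fin 2 → Γ}
    [Module (weightRing k w) M] [Module.Finite (weightRing k w) M] {x y : weightRing k w}
    (hx : x ∈ maximalIdeal (weightRing k w)) (hy : y ∈ maximalIdeal (weightRing k w))
    (hxy : IsWeaklyRegular M [x, y]) :
    ∃ (r : ℕ) (χ : Fin r → Γ), Nonempty (M ≃ₗ[weightRing k w] ∀ t, weightPart k w (χ t)) := by
  cases nonempty_fintype Γ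
  rw [mem_maximalIdeal_weightRing_iff, ← mem_maximalIdeal_iff_constantCoeff_eq_zero,
    maximalIdeal_eq_span_X_pair] at hx hy
  obtain ⟨r, e, χ, he⟩ := (Coinduced.grading k w M).exists_homogeneous_basis
    (.of_isWeaklyRegular hx hy (Coinduced.isWeaklyRegular_algebraMap hxy))
  exact ⟨r, fun t => -χ t, ⟨(Coinduced.gradingZeroPartEquiv k w M).symm ≪≫ₗ
    ((Coinduced.grading k w M).zeroPartEquiv e he).symm⟩⟩

theorem nontrivial_weightPart {w : σ → Γ} {s : σ} (hw : AddSubgroup.zmultiples (w s) = ⊤) (χ : Γ) :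
    Nontrivial (weightPart k w χ) := by
  obtain ⟨i, hi⟩ := exists_X_pow_mem_weightPart (k := k) hw χ
  exact ⟨⟨_, hi⟩, 0, fun h => pow_ne_zero i (X_ne_zero s) (congrArg Subtype.val h)⟩

theorem IsMCM.exists_equiv_weightPart {w : Fin 2 → Γ} {s : Fin 2}
    (hw : AddSubgroup.zmultiples (w s) = ⊤) [Module (weightRing k w) M]
    (hM : IsMCM (weightRing k w) M) (hM' : IsIndecomposable (weightRing k w) M) :
    ∃ χ, Nonempty (M ≃ₗ[weightRing k w] weightPart k w χ) := by
  have := hM.1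
  have hdepth : 2 ≤ depth (weightRing k w) M :=
    (WithBot.coe_inj.1 (hM.2.trans (ringKrullDim_weightRing w))).ge
  obtain ⟨x, hx, y, hy, hxy⟩ := exists_isWeaklyRegular_pair_of_two_le_depth hdepth
  obtain ⟨r, χ, ⟨e⟩⟩ := exists_equiv_pi_weightPart_of_isWeaklyRegular hx hy hxy
  have := hM'.1
  obtain ⟨t⟩ : Nonempty (Fin r) := by
    by_contra h
    rw [not_nonempty_iff] at h
    exact not_subsingleton M e.toEquiv.subsingleton
  have := nontrivial_weightPart (k := k) hw (χ t)
  let f := LinearMap.proj t ∘ₗ e.toLinearMap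
  let g := e.symm.toLinearMap ∘ₗ LinearMap.single _ (fun t => weightPart k w (χ t)) t
  have hfg : f ∘ₗ g = LinearMap.id := by
    ext
    simp [f, g]
  exact ⟨χ t, hM'.exists_equiv_of_comp_eq_id (P := weightPart k w (χ t)) hfg⟩

end MaximalCohenMacaulay

/-! ### Multiplicities of direct summands -/

section Multiplicity

variable {R κ M X : Type*} [CommRing R] [Field κ] [AddCommGroup M] [Module R M]
  [AddCommGroup X] [Module R X]

theorem hasSummand_of_comp_eq_id {f : M →ₗ[R] X} {g : X →ₗ[R] M} (h : g ∘ₗ f = LinearMap.id) :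
    HasSummand R M X :=
  ⟨_, _, isCompl_range_ker_of_comp_eq_id h, ⟨(LinearEquiv.ofInjective f
    (Function.LeftInverse.injective (LinearMap.congr_fun h))).symm⟩⟩

theorem HasSummand.exists_comp_eq_id (h : HasSummand R M X) :
    ∃ (f : M →ₗ[R] X) (g : X →ₗ[R] M), g ∘ₗ f = LinearMap.id := by
  obtain ⟨P, N, hPN, ⟨e⟩⟩ := h
  exact ⟨P.subtype ∘ₗ e.symm.toLinearMap, e.toLinearMap ∘ₗ P.projectionOnto N hPN,
    LinearMap.ext fun m => by simp⟩

/-- `X` is the direct sum of a copy of `M ^ ι` and of a module such that all endomorphisms of `M`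
that factor through it are killed by the character `ε` of the endomorphism ring of `M`. If `ε` is
the residue map of a local endomorphism ring, then `ι` counts the summands `M` of `X`. -/
def SplitsOff (ε : Module.End R M →+* κ) (X : Type*) [AddCommGroup X] [Module R X]
    (ι : Type*) : Prop :=
  ∃ (i : (ι → M) →ₗ[R] X) (p : X →ₗ[R] (ι → M)), p ∘ₗ i = LinearMap.id ∧
    ∀ (f : M →ₗ[R] X) (g : X →ₗ[R] M), ε (g ∘ₗ (LinearMap.id - i ∘ₗ p) ∘ₗ f) = 0

namespace SplitsOff

variable {ε : Module.End R M →+* κ} {ι ι' : Type*}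

theorem map_comp_eq_sum [Fintype ι] [DecidableEq ι] {i : (ι → M) →ₗ[R] X} {p : X →ₗ[R] (ι → M)}
    (hε : ∀ (f : M →ₗ[R] X) (g : X →ₗ[R] M), ε (g ∘ₗ (LinearMap.id - i ∘ₗ p) ∘ₗ f) = 0)
    (f : M →ₗ[R] X) (g : X →ₗ[R] M) :
    ε (g ∘ₗ f) = ∑ t, ε (g ∘ₗ i ∘ₗ LinearMap.single R (fun _ => M) t) *
      ε (LinearMap.proj t ∘ₗ p ∘ₗ f) := by
  have hsum : g ∘ₗ f = g ∘ₗ (LinearMap.id - i ∘ₗ p) ∘ₗ f +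
      ∑ t, (g ∘ₗ i ∘ₗ LinearMap.single R (fun _ => M) t) ∘ₗ (LinearMap.proj t ∘ₗ p ∘ₗ f) := by
    ext m
    have hp : ∑ t, Pi.single t (p (f m) t) = p (f m) := Finset.univ_sum_single _
    simp only [LinearMap.add_apply, LinearMap.sum_apply, LinearMap.comp_apply,
      LinearMap.sub_apply, LinearMap.id_apply, LinearMap.proj_apply, LinearMap.single_apply]
    rw [← map_sum g, ← map_sum i, hp, map_sub, sub_add_cancel]
  rw [hsum, map_add, hε, zero_add, map_sum]
  exact Finset.sum_congr rfl fun t _ => map_mul ε _ _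

/- Modulo the kernel of `ε`, the composition `g ∘ f` factors through a vector space of dimension
`Nat.card ι`. -/
theorem natCard_le [Finite ι] [Finite ι'] (h : SplitsOff ε X ι) {f : (ι' → M) →ₗ[R] X}
    {g : X →ₗ[R] (ι' → M)} (hgf : g ∘ₗ f = LinearMap.id) : Nat.card ι' ≤ Nat.card ι := by
  classical
  cases nonempty_fintype ι
  cases nonempty_fintype ι'
  obtain ⟨i, p, -, hε⟩ := h
  let A : Matrix ι' ι κ := fun r t =>
    ε ((LinearMap.proj r ∘ₗ g) ∘ₗ i ∘ₗ LinearMap.single R (fun _ => M) t)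
  let B : Matrix ι ι' κ := fun t s =>
    ε (LinearMap.proj t ∘ₗ p ∘ₗ f ∘ₗ LinearMap.single R (fun _ => M) s)
  have hAB : A * B = 1 := by
    ext r s
    have hrs : (LinearMap.proj r ∘ₗ g) ∘ₗ f ∘ₗ LinearMap.single R (fun _ => M) s =
        LinearMap.proj r ∘ₗ LinearMap.single R (fun _ => M) s :=
      LinearMap.ext fun m => congrFun (LinearMap.congr_fun hgf _) r
    rw [Matrix.mul_apply, ← map_comp_eq_sum hε, hrs, Matrix.one_apply]
    split_ifs with h
    · rw [h, LinearMap.proj_comp_single_same]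
      exact map_one ε
    · rw [LinearMap.proj_comp_single_ne _ _ _ _ h, map_zero]
  have hrank := (Matrix.rank_mul_le_left A B).trans (Matrix.rank_le_card_width A)
  rwa [hAB, Matrix.rank_one, ← Nat.card_eq_fintype_card, ← Nat.card_eq_fintype_card] at hrank

theorem natCard_eq [Finite ι] [Finite ι'] (h : SplitsOff ε X ι) (h' : SplitsOff ε X ι') :
    Nat.card ι = Nat.card ι' := by
  obtain ⟨i, p, hip, -⟩ := id h
  obtain ⟨i', p', hip', -⟩ := id h'
  exact le_antisymm (h'.natCard_le hip) (h.natCard_le hip')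

theorem isMultiplicity {b : ℕ} (h : SplitsOff ε X (Fin b)) : IsMultiplicity R M X b := by
  obtain ⟨i, p, hip, hε⟩ := h
  have hinj : Function.Injective i := Function.LeftInverse.injective (LinearMap.congr_fun hip)
  refine ⟨_, _, isCompl_range_ker_of_comp_eq_id hip, ⟨(LinearEquiv.ofInjective i hinj).symm⟩,
    fun hsummand => ?_⟩
  obtain ⟨f, g, hgf⟩ := hsummand.exists_comp_eq_id
  let j : X →ₗ[R] LinearMap.ker p := LinearMap.codRestrict _ (LinearMap.id - i ∘ₗ p) fun x => by
    simpa [sub_eq_zero] using (LinearMap.congr_fun hip (p x)).symm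
  have hj (x : LinearMap.ker p) : j x = x := Subtype.ext (by simp [j])
  have hid : (g ∘ₗ j) ∘ₗ (LinearMap.id - i ∘ₗ p) ∘ₗ ((LinearMap.ker p).subtype ∘ₗ f) =
      LinearMap.id := by
    ext m
    change g (j (j (f m))) = m
    rw [hj, hj]
    exact LinearMap.congr_fun hgf m
  refine one_ne_zero (α := κ) ?_
  rw [← map_one ε, ← hε ((LinearMap.ker p).subtype ∘ₗ f) (g ∘ₗ j), hid]
  rfl

theorem congr (h : SplitsOff ε X ι) {M' X' : Type*} [AddCommGroup M'] [Module R M']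
    [AddCommGroup X'] [Module R X'] (e : X ≃ₗ[R] X') (e' : M' ≃ₗ[R] M) (eι : ι ≃ ι') :
    SplitsOff (ε.comp (e'.conjRingEquiv : Module.End R M' →+* Module.End R M)) X' ι' := by
  obtain ⟨i, p, hip, hε⟩ := h
  let c : (ι' → M') ≃ₗ[R] (ι → M) :=
    LinearEquiv.funCongrLeft R M' eι ≪≫ₗ LinearEquiv.piCongrRight fun _ => e'
  refine ⟨e.toLinearMap ∘ₗ i ∘ₗ c.toLinearMap, c.symm.toLinearMap ∘ₗ p ∘ₗ e.symm.toLinearMap,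
    ?_, fun f g => ?_⟩
  · ext1 m
    have hc : p (i (c m)) = c m := LinearMap.congr_fun hip _
    simp [hc]
  · refine Eq.trans (congrArg ε ?_) (hε (e.symm.toLinearMap ∘ₗ f ∘ₗ e'.symm.toLinearMap)
      (e'.toLinearMap ∘ₗ g ∘ₗ e.toLinearMap))
    ext m
    simp [LinearEquiv.conjRingEquiv]

end SplitsOff

theorem IsMultiplicity.splitsOff {ε : Module.End R M →+* κ} (hε : ∀ φ, ε φ ≠ 0 → IsUnit φ) {b : ℕ}
    (h : IsMultiplicity R M X b) : SplitsOff ε X (Fin b) := by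
  obtain ⟨P, N, hPN, ⟨e⟩, hN⟩ := h
  refine ⟨P.subtype ∘ₗ e.symm.toLinearMap, e.toLinearMap ∘ₗ P.projectionOnto N hPN,
    LinearMap.ext fun m => by simp, fun f g => ?_⟩
  by_contra hne
  obtain ⟨φ, hφ⟩ := hε _ hne
  let j : X →ₗ[R] N := N.projectionOnto P hPN.symm
  have hj : LinearMap.id - (P.subtype ∘ₗ e.symm.toLinearMap) ∘ₗ e.toLinearMap ∘ₗ
      P.projectionOnto N hPN = N.subtype ∘ₗ j := by
    ext x
    simpa [j, sub_eq_iff_eq_add'] using (Submodule.projection_add_projection_eq_self hPN x).symm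
  refine hN (hasSummand_of_comp_eq_id (f := j ∘ₗ f)
    (g := (φ⁻¹ : (Module.End R M)ˣ).val ∘ₗ g ∘ₗ N.subtype) ?_)
  rw [hj] at hφ
  change (φ⁻¹ : (Module.End R M)ˣ).val * (g ∘ₗ (N.subtype ∘ₗ j) ∘ₗ f) = 1
  rw [← hφ, Units.inv_mul]

namespace SplitsOff

variable {ι : Type*} [Finite ι]

theorem isMultiplicity_iff {ε : Module.End R M →+* κ} (hε : ∀ φ, ε φ ≠ 0 → IsUnit φ)
    (h : SplitsOff ε X ι) (b : ℕ) : IsMultiplicity R M X b ↔ b = Nat.card ι := by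
  constructor
  · intro hb
    simpa using (hb.splitsOff hε).natCard_eq h
  · rintro rfl
    exact (h.congr (.refl R X) (.refl R M) (Finite.equivFin ι)).isMultiplicity

theorem freeRank_eq {ε : Module.End R R →+* κ} (h : SplitsOff ε X ι) :
    freeRank R X = Nat.card ι := by
  refine IsGreatest.csSup_eq ⟨?_, ?_⟩
  · obtain ⟨i, p, hip, -⟩ := h.congr (.refl R X) (.refl R R) (Finite.equivFin ι)
    exact ⟨p, i, hip⟩
  · rintro m ⟨φ, ψ, hφψ⟩
    simpa using h.natCard_le hφψ

end SplitsOff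

theorem splitsOff_pi {T : Type*} [Finite T] {N : T → Type*} [∀ t, AddCommGroup (N t)]
    [∀ t, Module R (N t)] {ε : Module.End R M →+* κ} {p : T → Prop}
    (e : ∀ t, p t → (N t ≃ₗ[R] M))
    (hε : ∀ t, ¬p t → ∀ (f : M →ₗ[R] N t) (g : N t →ₗ[R] M), ε (g ∘ₗ f) = 0) :
    SplitsOff ε (∀ t, N t) {t // p t} := by
  classical
  cases nonempty_fintype T
  let i : ({t // p t} → M) →ₗ[R] ∀ t, N t := LinearMap.pi fun t =>
    if h : p t then (e t h).symm.toLinearMap ∘ₗ LinearMap.proj (⟨t, h⟩ : {t // p t}) else 0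
  let q : (∀ t, N t) →ₗ[R] ({t // p t} → M) :=
    LinearMap.pi fun t => (e t t.2).toLinearMap ∘ₗ LinearMap.proj t.1
  have i_apply x {t} (h : p t) : i x t = (e t h).symm (x ⟨t, h⟩) := by simp [i, h]
  have hiq : LinearMap.id - i ∘ₗ q =
      ∑ t : {t // ¬p t}, LinearMap.single R N t ∘ₗ LinearMap.proj t.1 := by
    refine LinearMap.ext fun x => funext fun t => ?_
    simp only [LinearMap.sub_apply, LinearMap.id_apply, LinearMap.comp_apply, LinearMap.sum_apply,
      Pi.sub_apply, Finset.sum_apply, LinearMap.single_apply, LinearMap.proj_apply]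
    by_cases h : p t
    · rw [i_apply _ h, Finset.sum_eq_zero fun s _ => Pi.single_eq_of_ne (by grind) _]
      simp [q]
    · rw [Finset.sum_eq_single ⟨t, h⟩ (fun s _ hs => Pi.single_eq_of_ne (by grind) _) (by simp)]
      simp [i, h]
  refine ⟨i, q, LinearMap.ext fun x => funext fun t => ?_, fun f g => ?_⟩
  · change e t t.2 (i x t) = x t
    rw [i_apply x t.2, LinearEquiv.apply_symm_apply]
  · have hsum : g ∘ₗ (LinearMap.id - i ∘ₗ q) ∘ₗ f = ∑ t : {t // ¬p t},
        (g ∘ₗ LinearMap.single R N t) ∘ₗ LinearMap.proj t.1 ∘ₗ f := by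
      ext m
      simp [hiq]
    rw [hsum, map_sum]
    exact Finset.sum_eq_zero fun t _ =>
      hε t t.2 (LinearMap.proj t.1 ∘ₗ f) (g ∘ₗ LinearMap.single R N t)

end Multiplicity

/-! ### Direct sums of parts of given weight -/

section Rank

variable {R X Y : Type*} [CommRing R] [IsDomain R] [AddCommGroup X] [Module R X]

theorem rank_eq_finrank : rank R X = Module.finrank R X := by
  rw [rank, IsLocalization.finrank_eq (FractionRing R) (nonZeroDivisors R) le_rfl,
    IsLocalizedModule.finrank_eq (nonZeroDivisors R)
      (LocalizedModule.mkLinearMap (nonZeroDivisors R) X) le_rfl]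

end Rank

section WeightPartSums

variable {σ Γ k : Type*} [AddCommGroup Γ] [Finite Γ] [Field k] {w : σ → Γ}

theorem rank_eq_natCard_of_equiv_pi_weightPart [Finite σ] {s : σ}
    (hw : AddSubgroup.zmultiples (w s) = ⊤)
    {T X : Type*} [Finite T] {χ : T → Γ} [AddCommGroup X] [Module (weightRing k w) X]
    (e : X ≃ₗ[weightRing k w] ∀ t, weightPart k w (χ t)) :
    rank (weightRing k w) X = Nat.card T := by
  cases nonempty_fintype T
  rw [rank_eq_finrank, e.finrank_eq, Nat.card_eq_fintype_card,
    ← Module.finrank_pi (weightRing k w) (ι := T),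
    ← (LinearEquiv.piCongrRight fun _ : T => weightPartZeroEquiv k w).finrank_eq]
  choose φ hφ using fun t => exists_injective_weightPart (k := k) hw (χ t) 0
  choose θ hθ using fun t => exists_injective_weightPart (k := k) hw 0 (χ t)
  exact le_antisymm
    (LinearMap.finrank_le_finrank_of_injective (f := LinearMap.piMap φ)
      (Function.Injective.piMap hφ))
    (LinearMap.finrank_le_finrank_of_injective (f := LinearMap.piMap θ)
      (Function.Injective.piMap hθ))

variable [Nontrivial σ] (hw : ∀ s, AddSubgroup.zmultiples (w s) = ⊤)

include hw in
theorem exists_mem_weightPart_forall_coe_eq_mul {χ ψ : Γ}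
    (φ : weightPart k w χ →ₗ[weightRing k w] weightPart k w ψ) :
    ∃ h ∈ weightPart k w (ψ - χ), ∀ f, (φ f : MvPowerSeries σ k) = f * h := by
  obtain ⟨h, hh⟩ := exists_linearMap_eq_mul hw ((weightPart k w ψ).subtype ∘ₗ φ)
  obtain ⟨s⟩ := ‹Nontrivial σ›.to_nonempty
  refine ⟨h, mem_weightPart_of_forall_prod_mul_mem (hw s) (χ := fun _ : Fin 1 => χ) fun f => ?_, hh⟩
  rw [Fin.prod_univ_one, ← hh, Fin.sum_univ_one, add_sub_cancel]
  exact (φ (f 0)).2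

include hw in
theorem eq_of_forall_mul_eq_mul {χ : Γ} {h h' : MvPowerSeries σ k}
    (hh : ∀ f : weightPart k w χ, (f : MvPowerSeries σ k) * h = f * h') : h = h' := by
  obtain ⟨s⟩ := ‹Nontrivial σ›.to_nonempty
  refine eq_of_forall_prod_mul_eq (hw s) (fun _ : Fin 1 => χ) fun f => ?_
  simpa using hh (f 0)

/-- The power series by which an endomorphism of the part of weight `χ` multiplies. -/
def endMultiplier (χ : Γ) : Module.End (weightRing k w) (weightPart k w χ) →+* MvPowerSeries σ k :=
  have H φ := (exists_mem_weightPart_forall_coe_eq_mul hw φ).choose_spec.2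
  { toFun φ := (exists_mem_weightPart_forall_coe_eq_mul hw φ).choose
    map_one' := eq_of_forall_mul_eq_mul hw fun f => by
      rw [← H, Module.End.one_apply, mul_one]
    map_mul' φ ψ := eq_of_forall_mul_eq_mul hw fun f => by
      rw [← H, Module.End.mul_apply, H, H, mul_right_comm, mul_assoc]
    map_zero' := eq_of_forall_mul_eq_mul hw fun f => by
      rw [← H, LinearMap.zero_apply, Submodule.coe_zero, mul_zero]
    map_add' φ ψ := eq_of_forall_mul_eq_mul hw fun f => by
      rw [← H, LinearMap.add_apply, Submodule.coe_add, H, H, mul_add] }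

theorem coe_apply_eq_mul_endMultiplier {χ : Γ}
    (φ : Module.End (weightRing k w) (weightPart k w χ)) (f : weightPart k w χ) :
    (φ f : MvPowerSeries σ k) = f * endMultiplier hw χ φ :=
  (exists_mem_weightPart_forall_coe_eq_mul hw φ).choose_spec.2 f

theorem endMultiplier_eq {χ : Γ} {φ : Module.End (weightRing k w) (weightPart k w χ)}
    {h : MvPowerSeries σ k} (hφ : ∀ f, (φ f : MvPowerSeries σ k) = f * h) :
    endMultiplier hw χ φ = h :=
  eq_of_forall_mul_eq_mul hw fun f => by rw [← coe_apply_eq_mul_endMultiplier, hφ]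

theorem endMultiplier_mem (χ : Γ) (φ : Module.End (weightRing k w) (weightPart k w χ)) :
    endMultiplier hw χ φ ∈ weightRing k w := by
  obtain ⟨h, hmem, hh⟩ := exists_mem_weightPart_forall_coe_eq_mul hw φ
  rw [endMultiplier_eq hw hh]
  rwa [sub_self] at hmem

/-- The residue map of the local endomorphism ring of the part of weight `χ`. -/
def endResidue (χ : Γ) : Module.End (weightRing k w) (weightPart k w χ) →+* k :=
  constantCoeff.comp (endMultiplier hw χ)

theorem isUnit_of_endResidue_ne_zero {χ : Γ} {φ : Module.End (weightRing k w) (weightPart k w χ)}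
    (hφ : endResidue hw χ φ ≠ 0) : IsUnit φ := by
  obtain ⟨r, hr⟩ := isUnit_weightRing_iff (r := ⟨_, endMultiplier_mem hw χ φ⟩).2 hφ
  have hφr : φ = (LinearEquiv.smulOfUnit (M := weightPart k w χ) r).toLinearMap := by
    refine LinearMap.ext fun f => Subtype.ext ?_
    rw [coe_apply_eq_mul_endMultiplier hw, mul_comm]
    exact congrArg (fun c : weightRing k w => (c : MvPowerSeries σ k) * f) hr.symm
  rw [hφr, Module.End.isUnit_iff]
  exact LinearEquiv.bijective _

theorem endResidue_comp_eq_zero {χ ψ : Γ} (hχ : χ ≠ ψ)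
    (f : weightPart k w ψ →ₗ[weightRing k w] weightPart k w χ)
    (g : weightPart k w χ →ₗ[weightRing k w] weightPart k w ψ) :
    endResidue hw ψ (g ∘ₗ f) = 0 := by
  obtain ⟨p, hp, hfp⟩ := exists_mem_weightPart_forall_coe_eq_mul hw f
  obtain ⟨q, -, hgq⟩ := exists_mem_weightPart_forall_coe_eq_mul hw g
  change constantCoeff (endMultiplier hw ψ (g ∘ₗ f)) = 0
  rw [endMultiplier_eq hw (h := p * q) fun s => by rw [LinearMap.comp_apply, hgq, hfp, mul_assoc],
    map_mul, constantCoeff_eq_zero_of_mem_weightPart (sub_ne_zero.2 hχ) hp, zero_mul]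

theorem splitsOff_pi_weightPart {T : Type*} [Finite T] (χ : T → Γ) (ψ : Γ) :
    SplitsOff (R := weightRing k w) (M := weightPart k w ψ) (endResidue hw ψ)
      (∀ t, weightPart k w (χ t)) {t // χ t = ψ} :=
  splitsOff_pi (fun _ h => .ofEq _ _ (congrArg _ h)) fun _ h => endResidue_comp_eq_zero hw h

variable {T M X : Type*} [Finite T] {χ : T → Γ} {ψ : Γ} [AddCommGroup M] [Module (weightRing k w) M]
  [AddCommGroup X] [Module (weightRing k w) X]

include hw

theorem isMultiplicity_iff_of_equiv_weightPart (eM : M ≃ₗ[weightRing k w] weightPart k w ψ)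
    (eX : X ≃ₗ[weightRing k w] ∀ t, weightPart k w (χ t)) (b : ℕ) :
    IsMultiplicity (weightRing k w) M X b ↔ b = Nat.card {t // χ t = ψ} := by
  refine SplitsOff.isMultiplicity_iff (fun φ hφ => ?_)
    ((splitsOff_pi_weightPart (k := k) hw χ ψ).congr eX.symm eM (Equiv.refl _)) b
  exact (MulEquiv.isUnit_map eM.conjRingEquiv).1 (isUnit_of_endResidue_ne_zero hw hφ)

theorem freeRank_eq_of_equiv_pi_weightPart (eX : X ≃ₗ[weightRing k w] ∀ t, weightPart k w (χ t)) :
    freeRank (weightRing k w) X = Nat.card {t // χ t = 0} :=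
  SplitsOff.freeRank_eq ((splitsOff_pi_weightPart (k := k) hw χ 0).congr eX.symm
    (weightPartZeroEquiv k w).symm (Equiv.refl _))

end WeightPartSums

/-! ### Reflexive symmetric powers -/

section SymmetricPower

variable {R ι : Type u} [CommSemiring R] {M : Type v} [AddCommMonoid M] [Module R M]
  {N : Type w} [AddCommMonoid N] [Module R N]

theorem symmetricPower_hom_ext {f g : SymmetricPower R ι M →ₗ[R] N}
    (h : ∀ x, f (SymmetricPower.tprod R x) = g (SymmetricPower.tprod R x)) : f = g :=
  LinearMap.ext_on_range (SymmetricPower.span_tprod_eq_top _ _ _) h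

/-- The linear map on the symmetric power that is given by a symmetric multilinear map. -/
def symmetricPowerLift (f : MultilinearMap R (fun _ : ι => M) N)
    (hf : ∀ (ρ : Equiv.Perm ι) (x : ι → M), f (fun i => x (ρ i)) = f x) :
    SymmetricPower R ι M →ₗ[R] N where
  toFun := AddCon.lift _ (PiTensorProduct.lift f).toAddMonoidHom (AddCon.addConGen_le.2 (by
    rintro _ _ ⟨ρ, x⟩
    refine AddCon.ker_apply.2 ?_
    rw [LinearMap.toAddMonoidHom_coe, PiTensorProduct.lift.tprod, PiTensorProduct.lift.tprod]
    exact (hf ρ x).symm))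
  map_add' := map_add _
  map_smul' r x := AddCon.induction_on x fun x => (PiTensorProduct.lift f).map_smul r x

theorem symmetricPowerLift_tprod (f : MultilinearMap R (fun _ : ι => M) N)
    (hf : ∀ (ρ : Equiv.Perm ι) (x : ι → M), f (fun i => x (ρ i)) = f x) (x : ι → M) :
    symmetricPowerLift f hf (SymmetricPower.tprod R x) = f x :=
  PiTensorProduct.lift.tprod x

/-- The map of symmetric powers that is induced by a linear map. -/
def symmetricPowerMap (f : M →ₗ[R] N) : SymmetricPower R ι M →ₗ[R] SymmetricPower R ι N :=
  symmetricPowerLift ((SymmetricPower.tprod R).compLinearMap fun _ => f) fun ρ x =>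
    SymmetricPower.tprod_equiv ρ fun i => f (x i)

theorem symmetricPowerMap_tprod (f : M →ₗ[R] N) (x : ι → M) :
    symmetricPowerMap f (SymmetricPower.tprod R x) = SymmetricPower.tprod R fun i => f (x i) :=
  symmetricPowerLift_tprod _ _ x

/-- The isomorphism of symmetric powers that is induced by an isomorphism of modules. -/
def symmetricPowerCongr (e : M ≃ₗ[R] N) : SymmetricPower R ι M ≃ₗ[R] SymmetricPower R ι N :=
  .ofLinearMap (symmetricPowerMap e.toLinearMap) (symmetricPowerMap e.symm.toLinearMap)
    (symmetricPower_hom_ext fun x => by simp [symmetricPowerMap_tprod])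
    (symmetricPower_hom_ext fun x => by simp [symmetricPowerMap_tprod])

theorem symmetricPower_pi_hom_ext [Finite ι] {T : Type*} [Finite T] [DecidableEq T] {P : T → Type*}
    [∀ t, AddCommMonoid (P t)] [∀ t, Module R (P t)]
    {f g : SymmetricPower R ι (∀ t, P t) →ₗ[R] N}
    (h : ∀ (r : ι → T) (s : ∀ i, P (r i)),
      f (SymmetricPower.tprod R fun i => Pi.single (r i) (s i)) =
        g (SymmetricPower.tprod R fun i => Pi.single (r i) (s i))) : f = g := by
  have hfg : f.compMultilinearMap (SymmetricPower.tprod R) =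
      g.compMultilinearMap (SymmetricPower.tprod R) :=
    MultilinearMap.pi_ext fun r => MultilinearMap.ext fun s => h r s
  exact symmetricPower_hom_ext fun x => congrArg (fun F => F x) hfg

end SymmetricPower

section MonomialOfFun

variable {ι T : Type*} [Fintype ι] {q : ℕ} (hι : Fintype.card ι = q)

/-- The monomial of degree `q` that is the unordered family of the values of `r`. -/
def symOfFun (r : ι → T) : Sym T q :=
  ⟨Finset.univ.val.map r, (Multiset.card_map _ _).trans hι⟩

theorem symOfFun_surjective : Function.Surjective (symOfFun (T := T) hι) := by
  subst hι
  rintro ⟨m, hm⟩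
  induction m using Quotient.inductionOn with | h l =>
  let e : ι ≃ Fin l.length := Fintype.equivFinOfCardEq hm.symm
  refine ⟨l.get ∘ e, Subtype.ext ?_⟩
  change Finset.univ.val.map (l.get ∘ e) = l
  rw [← Multiset.map_map, Multiset.map_univ_val_equiv, Fin.univ_val_map, List.ofFn_get]

theorem symOfFun_comp_perm (r : ι → T) (ρ : Equiv.Perm ι) :
    symOfFun hι (r ∘ ρ) = symOfFun hι r :=
  Subtype.ext (by
    change Finset.univ.val.map (r ∘ ρ) = Finset.univ.val.map r
    rw [← Multiset.map_map, Multiset.map_univ_val_equiv])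

theorem exists_perm_of_symOfFun_eq {r r' : ι → T} (h : symOfFun hι r = symOfFun hι r') :
    ∃ ρ : Equiv.Perm ι, r = r' ∘ ρ := by
  classical
  have hcard (t) : Fintype.card {i // r i = t} = Fintype.card {i // r' i = t} := by
    have hcount := congrArg (fun m : Sym T q => (m : Multiset T).count t) h
    simp only [Fintype.card_subtype, eq_comm (b := t)]
    exact (Multiset.count_map _ _ _).symm.trans (hcount.trans (Multiset.count_map _ _ _))
  refine ⟨Equiv.ofFiberEquiv fun t => Fintype.equivOfCardEq (hcard t), funext fun i => ?_⟩
  exact (Equiv.ofFiberEquiv_map _ i).symm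

/-- The weight of a monomial in variables of weights `χ`. -/
def monomialWeight {Γ : Type*} [AddCommMonoid Γ] (χ : T → Γ) (m : Sym T q) : Γ :=
  ((m : Multiset T).map χ).sum

theorem monomialWeight_symOfFun {Γ : Type*} [AddCommMonoid Γ] (χ : T → Γ) (r : ι → T) :
    monomialWeight χ (symOfFun hι r) = ∑ i, χ (r i) :=
  congrArg Multiset.sum (Multiset.map_map χ r Finset.univ.val)

end MonomialOfFun

section DualOfWeightPart

variable {σ Γ k : Type*} [AddCommGroup Γ] [Finite Γ] [Field k] {w : σ → Γ} [Nontrivial σ]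
  (hw : ∀ s, AddSubgroup.zmultiples (w s) = ⊤)

/-- The multiplication of the parts of the weights `χ` and `-χ`, as a pairing. -/
def weightPairing (k : Type*) [Field k] (w : σ → Γ) (χ : Γ) : weightPart k w (-χ) →ₗ[weightRing k w]
    weightPart k w χ →ₗ[weightRing k w] weightRing k w :=
  LinearMap.mk₂ _
    (fun h f => weightPartZeroEquiv k w ⟨f * h, add_neg_cancel χ ▸ mul_mem_weightPart f.2 h.2⟩)
    (fun _ _ _ => Subtype.ext (mul_add _ _ _)) (fun _ _ _ => Subtype.ext (mul_left_comm _ _ _))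
    (fun _ _ _ => Subtype.ext (add_mul _ _ _)) (fun _ _ _ => Subtype.ext (mul_assoc _ _ _))

include hw in
theorem weightPairing_bijective (χ : Γ) : Function.Bijective (weightPairing k w χ) := by
  refine ⟨fun h h' hh => Subtype.ext (eq_of_forall_mul_eq_mul hw (χ := χ) fun f => ?_), fun l => ?_⟩
  · exact congrArg Subtype.val (LinearMap.congr_fun hh f)
  · obtain ⟨h, hmem, hh⟩ := exists_mem_weightPart_forall_coe_eq_mul hw
      ((weightPartZeroEquiv k w).symm.toLinearMap ∘ₗ l)
    refine ⟨⟨h, zero_sub χ ▸ hmem⟩, LinearMap.ext fun f => Subtype.ext (hh f).symm⟩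

/-- The dual of a direct sum of parts of given weight. -/
def dualPiWeightPartEquiv {T : Type*} [Fintype T] [DecidableEq T] (χ : T → Γ) :
    (∀ t, weightPart k w (-χ t)) ≃ₗ[weightRing k w]
      Module.Dual (weightRing k w) (∀ t, weightPart k w (χ t)) :=
  (LinearEquiv.piCongrRight fun t => .ofBijective _ (weightPairing_bijective hw (χ t))) ≪≫ₗ
    LinearMap.lsum _ (fun t => weightPart k w (χ t)) (weightRing k w)

theorem dualPiWeightPartEquiv_single {T : Type*} [Fintype T] [DecidableEq T] (χ : T → Γ)
    (h : ∀ t, weightPart k w (-χ t)) (t : T) (f : weightPart k w (χ t)) :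
    (dualPiWeightPartEquiv hw χ h (Pi.single t f) : MvPowerSeries σ k) = f * h t := by
  have hsingle : dualPiWeightPartEquiv hw χ h (Pi.single t f) = weightPairing k w (χ t) (h t) f :=
    LinearMap.lsum_piSingle _ _ (weightRing k w) (fun t => weightPairing k w (χ t) (h t)) t f
  rw [hsingle]
  rfl

end DualOfWeightPart

section SymmetricProducts

variable {σ : Type v} {Γ : Type*} {k : Type u} [AddCommGroup Γ] [Field k] {w : σ → Γ}
  {ι : Type (max u v)} [Fintype ι] {q : ℕ} (hι : Fintype.card ι = q)
  {T : Type*} (χ : T → Γ)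

theorem exists_forall_apply_tprod_single_eq [Finite Γ] [Nontrivial σ]
    (hw : ∀ s, AddSubgroup.zmultiples (w s) = ⊤) [DecidableEq T] (l : Module.Dual (weightRing k w)
      (SymmetricPower (weightRing k w) ι (∀ t, weightPart k w (χ t)))) :
    ∃ h : ∀ m : Sym T q, weightPart k w (-monomialWeight χ m),
      ∀ (r : ι → T) (s : ∀ i, weightPart k w (χ (r i))),
        (l (SymmetricPower.tprod _ fun i => Pi.single (r i) (s i)) : MvPowerSeries σ k) =
          (∏ i, (s i : MvPowerSeries σ k)) * h (symOfFun hι r) := by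
  obtain ⟨s₀⟩ := ‹Nontrivial σ›.to_nonempty
  choose H hH using fun r : ι → T => exists_multilinearMap_eq_prod_mul (k := k) hw
    ((Algebra.linearMap (weightRing k w) (MvPowerSeries σ k) ∘ₗ l).compMultilinearMap
      ((SymmetricPower.tprod (weightRing k w)).compLinearMap fun i =>
        LinearMap.single _ (fun t => weightPart k w (χ t)) (r i)))
  replace hH (r : ι → T) (s : ∀ i, weightPart k w (χ (r i))) :
      (l (SymmetricPower.tprod _ fun i => Pi.single (r i) (s i)) : MvPowerSeries σ k) =
        (∏ i, (s i : MvPowerSeries σ k)) * H r := hH r s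
  have hHmem (r : ι → T) : H r ∈ weightPart k w (-∑ i, χ (r i)) := by
    refine mem_weightPart_of_forall_prod_mul_mem (hw s₀) (χ := fun i => χ (r i)) fun s => ?_
    rw [← hH, add_neg_cancel]
    exact (l _).2
  have hHperm (r : ι → T) (ρ : Equiv.Perm ι) : H (r ∘ ρ) = H r := by
    refine eq_of_forall_prod_mul_eq (hw s₀) (fun i => χ (r i)) fun s => ?_
    rw [← hH, ← SymmetricPower.tprod_equiv ρ, ← Equiv.prod_comp ρ]
    exact (hH (r ∘ ρ) fun i => s (ρ i)).symm
  choose rep hrep using symOfFun_surjective (T := T) hι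
  refine ⟨fun m => ⟨H (rep m), ?_⟩, fun r s => ?_⟩
  · rw [← congrArg (monomialWeight χ) (hrep m), monomialWeight_symOfFun]
    exact hHmem (rep m)
  · obtain ⟨ρ, hρ⟩ := exists_perm_of_symOfFun_eq hι (hrep (symOfFun hι r))
    rw [hH, ← hHperm r ρ, ← hρ]

variable [Fintype T]

open Classical in
/-- The coefficient at the monomial `m` of the product of the linear forms `x i`, where an element
of a direct sum over `T` is read as a linear form in variables that are indexed by `T`. -/
def formProductCoeff (k : Type u) [Field k] (w : σ → Γ) (m : Sym T q) :
    MultilinearMap (weightRing k w) (fun _ : ι => ∀ t, weightPart k w (χ t)) (MvPowerSeries σ k) :=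
  ∑ r : ι → T with symOfFun hι r = m,
    (MultilinearMap.mkPiAlgebra (weightRing k w) ι (MvPowerSeries σ k)).compLinearMap fun i =>
      (weightPart k w (χ (r i))).subtype ∘ₗ LinearMap.proj (r i)

open Classical in
theorem formProductCoeff_apply (m : Sym T q) (x : ι → ∀ t, weightPart k w (χ t)) :
    formProductCoeff hι χ k w m x =
      ∑ r : ι → T with symOfFun hι r = m, ∏ i, (x i (r i) : MvPowerSeries σ k) := by
  simp [formProductCoeff]

theorem formProductCoeff_mem (m : Sym T q) (x : ι → ∀ t, weightPart k w (χ t)) :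
    formProductCoeff hι χ k w m x ∈ weightPart k w (monomialWeight χ m) := by
  classical
  rw [formProductCoeff_apply]
  refine sum_mem fun r hr => ?_
  rw [← (Finset.mem_filter.1 hr).2, monomialWeight_symOfFun]
  exact prod_mem_weightPart _ fun i _ => (x i (r i)).2

theorem formProductCoeff_comp_perm (m : Sym T q) (ρ : Equiv.Perm ι)
    (x : ι → ∀ t, weightPart k w (χ t)) :
    formProductCoeff hι χ k w m (fun i => x (ρ i)) = formProductCoeff hι χ k w m x := by
  classical
  rw [formProductCoeff_apply, formProductCoeff_apply]
  refine Finset.sum_equiv (Equiv.arrowCongr ρ (Equiv.refl T)) (fun r => ?_) fun r _ => ?_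
  · simp only [Finset.mem_filter, Finset.mem_univ, true_and]
    exact Eq.congr_left (symOfFun_comp_perm hι r ρ.symm).symm
  · exact Fintype.prod_equiv ρ _ _ fun i => by
      rw [show Equiv.arrowCongr ρ (Equiv.refl T) r (ρ i) = r i from
        congrArg r (ρ.symm_apply_apply i)]

/-- The symmetric power of a direct sum, mapped to the direct sum over the monomials by taking the
coefficients of a product of linear forms. -/
def formProduct (k : Type u) [Field k] (w : σ → Γ) :
    SymmetricPower (weightRing k w) ι (∀ t, weightPart k w (χ t)) →ₗ[weightRing k w]
      ∀ m : Sym T q, weightPart k w (monomialWeight χ m) :=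
  symmetricPowerLift
    (.pi fun m => (formProductCoeff hι χ k w m).codRestrict _ (formProductCoeff_mem hι χ m))
    fun ρ x => funext fun m => Subtype.ext (formProductCoeff_comp_perm hι χ m ρ x)

theorem formProduct_tprod_apply (x : ι → ∀ t, weightPart k w (χ t)) (m : Sym T q) :
    formProduct hι χ k w (SymmetricPower.tprod _ x) m =
      ⟨formProductCoeff hι χ k w m x, formProductCoeff_mem hι χ m x⟩ :=
  congrFun (symmetricPowerLift_tprod (.pi fun m =>
    (formProductCoeff hι χ k w m).codRestrict _ (formProductCoeff_mem hι χ m)) _ x) m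

open Classical in
theorem formProduct_tprod_single (r : ι → T)
    (s : ∀ i, weightPart k w (χ (r i))) :
    formProduct hι χ k w (SymmetricPower.tprod _ fun i => Pi.single (r i) (s i)) =
      Pi.single (symOfFun hι r) ⟨∏ i, (s i : MvPowerSeries σ k), monomialWeight_symOfFun hι χ r ▸
        prod_mem_weightPart _ fun i _ => (s i).2⟩ := by
  have hr' (r' : ι → T) (hrr' : r' ≠ r) :
      ∏ i, ((Pi.single (r i) (s i) : ∀ t, weightPart k w (χ t)) (r' i) : MvPowerSeries σ k) =
        0 := by
    obtain ⟨i, hi⟩ := Function.ne_iff.1 hrr'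
    refine Finset.prod_eq_zero (Finset.mem_univ i) ?_
    rw [Pi.single_eq_of_ne hi, Submodule.coe_zero]
  refine funext fun m => Subtype.ext ?_
  rw [formProduct_tprod_apply]
  refine (formProductCoeff_apply hι χ m _).trans ?_
  by_cases hm : m = symOfFun hι r
  · subst hm
    rw [Finset.sum_eq_single r (fun r' _ => hr' r') (by simp), Pi.single_eq_same]
    simp only [Pi.single_eq_same]
  · rw [Pi.single_eq_of_ne hm, Submodule.coe_zero]
    refine Finset.sum_eq_zero fun r' h => hr' r' ?_
    rintro rfl
    exact hm (Finset.mem_filter.1 h).2.symm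

variable [Finite Γ] [Nontrivial σ] (hw : ∀ s, AddSubgroup.zmultiples (w s) = ⊤)

include hw in
theorem formProduct_dualMap_injective : Function.Injective (formProduct hι χ k w).dualMap := by
  classical
  intro l l' hl
  obtain ⟨s₀⟩ := ‹Nontrivial σ›.to_nonempty
  obtain ⟨h, rfl⟩ := (dualPiWeightPartEquiv hw (monomialWeight χ)).surjective l
  obtain ⟨h', rfl⟩ := (dualPiWeightPartEquiv hw (monomialWeight χ)).surjective l'
  refine congrArg _ (funext fun m => Subtype.ext ?_)
  obtain ⟨r, rfl⟩ := symOfFun_surjective hι m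
  refine eq_of_forall_prod_mul_eq (hw s₀) (fun i => χ (r i)) fun s => ?_
  have hs := LinearMap.congr_fun hl
    (SymmetricPower.tprod _ fun i => (Pi.single (r i) (s i) : ∀ t, weightPart k w (χ t)))
  rw [LinearMap.dualMap_apply, LinearMap.dualMap_apply, formProduct_tprod_single] at hs
  replace hs := congrArg Subtype.val hs
  rwa [dualPiWeightPartEquiv_single, dualPiWeightPartEquiv_single] at hs

include hw in
theorem formProduct_dualMap_surjective : Function.Surjective (formProduct hι χ k w).dualMap := by
  classical
  intro l
  obtain ⟨h, hh⟩ := exists_forall_apply_tprod_single_eq hι χ hw l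
  refine ⟨dualPiWeightPartEquiv hw _ h, symmetricPower_pi_hom_ext fun r s => Subtype.ext ?_⟩
  rw [LinearMap.dualMap_apply, formProduct_tprod_single, dualPiWeightPartEquiv_single, hh]

end SymmetricProducts

theorem exists_equiv_reflexiveSymmetricPower {σ : Type v} {Γ : Type*} {k : Type u} [AddCommGroup Γ]
    [Field k] {w : σ → Γ} [Finite Γ] [Nontrivial σ] (hw : ∀ s, AddSubgroup.zmultiples (w s) = ⊤)
    (q : ℕ) {T L : Type*} [Finite T] {χ : T → Γ} [AddCommGroup L] [Module (weightRing k w) L]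
    (e : L ≃ₗ[weightRing k w] ∀ t, weightPart k w (χ t)) :
    Nonempty (ReflexiveSymmetricPower (weightRing k w) q L ≃ₗ[weightRing k w]
      ∀ m : Sym T q, weightPart k w (monomialWeight χ m)) := by
  classical
  cases nonempty_fintype T
  have hq : Fintype.card (ULift.{max u v} (Fin q)) = q := by simp
  let symDual := LinearEquiv.ofBijective (formProduct hq χ k w).dualMap
    ⟨formProduct_dualMap_injective hq χ hw, formProduct_dualMap_surjective hq χ hw⟩
  let biDual := dualPiWeightPartEquiv (k := k) hw fun m : Sym T q => -monomialWeight χ m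
  rw [show monomialWeight χ = fun m : Sym T q => - -monomialWeight χ m from
    funext fun m => (neg_neg _).symm]
  exact ⟨(((dualPiWeightPartEquiv hw (monomialWeight χ) ≪≫ₗ symDual) ≪≫ₗ
    (symmetricPowerCongr e).dualMap).dualMap) ≪≫ₗ biDual.symm⟩

/-! ### The second syzygy module of the residue field -/

section Syzygies

theorem exists_generators_residueField_eq_singleton (R : Type u) [CommRing R] [IsLocalRing R] :
    ∃ c ≠ 0, (⊤ : Submodule R (ResidueField R)).generators = {c} := by
  have htop : (⊤ : Submodule R (ResidueField R)) = Submodule.span R {1} := by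
    refine (eq_top_iff.2 fun x _ => ?_).symm
    obtain ⟨r, rfl⟩ := residue_surjective x
    refine Submodule.mem_span_singleton.2 ⟨r, ?_⟩
    rw [Algebra.smul_def, mul_one]
    rfl
  have hfg : (⊤ : Submodule R (ResidueField R)).FG := htop ▸ Submodule.fg_span_singleton 1
  obtain ⟨c, hc⟩ : ∃ c, (⊤ : Submodule R (ResidueField R)).generators = {c} := by
    rw [← Set.ncard_eq_one, hfg.generators_ncard]
    nth_rw 1 [htop]
    exact Submodule.spanFinrank_singleton one_ne_zero
  refine ⟨c, ?_, hc⟩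
  rintro rfl
  have hspan := (⊤ : Submodule R (ResidueField R)).span_generators
  rw [hc, Submodule.span_zero_singleton] at hspan
  exact bot_ne_top hspan

theorem exists_equiv_syzygy_one (R : Type u) [CommRing R] [IsLocalRing R] :
    Nonempty (syzygy R 1 (ModuleCat.of R (ResidueField R)) ≃ₗ[R] maximalIdeal R) := by
  obtain ⟨c, hc0, hc⟩ := exists_generators_residueField_eq_singleton R
  let _ : Unique (⊤ : Submodule R (ResidueField R)).generators :=
    { default := ⟨c, hc.ge rfl⟩
      uniq x := Subtype.ext (hc.subset x.2) }
  let coord := Finsupp.uniqueLinearEquiv R R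
    (default : (⊤ : Submodule R (ResidueField R)).generators)
  have hker : LinearMap.ker (minimalCover R (ResidueField R)) =
      Submodule.comap coord.toLinearMap (maximalIdeal R) := by
    ext f
    rw [LinearMap.mem_ker, minimalCover, Finsupp.linearCombination_unique]
    change f default • c = 0 ↔ f default ∈ maximalIdeal R
    rw [Algebra.smul_def, mul_eq_zero, or_iff_left hc0]
    exact residue_eq_zero_iff _
  exact ⟨(LinearEquiv.ofEq _ _ hker).trans (coord.ofSubmodule' (maximalIdeal R))⟩

theorem exists_equiv_ker_minimalCover (R : Type u) [CommRing R] (M : Type v) [AddCommGroup M]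
    [Module R M] [Module.Finite R M] :
    ∃ (G : Type v) (_ : Fintype G) (g : G → M), Submodule.span R (Set.range g) = ⊤ ∧
      Nonempty (LinearMap.ker (minimalCover R M) ≃ₗ[R]
        LinearMap.ker (Fintype.linearCombination R g)) := by
  let G := (⊤ : Submodule R M).generators
  have : Finite G := Module.Finite.fg_top.finite_generators
  let _ : Fintype G := Fintype.ofFinite G
  let toFun := Finsupp.linearEquivFunOnFinite R R G
  have hker : LinearMap.ker (minimalCover R M) =
      (LinearMap.ker (Fintype.linearCombination R (Subtype.val : G → M))).comap
        toFun.toLinearMap := by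
    ext f
    obtain ⟨h, rfl⟩ := toFun.symm.surjective f
    change Finsupp.linearCombination R _ _ = 0 ↔ Fintype.linearCombination R _ h = 0
    rw [← Finsupp.linearCombination_eq_fintype_linearCombination_apply R]
  refine ⟨G, inferInstance, Subtype.val, ?_, ⟨LinearEquiv.ofEq _ _ hker ≪≫ₗ toFun.ofSubmodule' _⟩⟩
  rw [Subtype.range_val, Submodule.span_generators]

theorem exists_equiv_syzygy_two (R : Type u) [CommRing R] [IsLocalRing R] [IsNoetherianRing R] :
    ∃ (G : Type u) (_ : Fintype G) (g : G → R),
      Submodule.span R (Set.range g) = maximalIdeal R ∧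
      Nonempty (syzygy R 2 (ModuleCat.of R (ResidueField R)) ≃ₗ[R]
        LinearMap.ker (Fintype.linearCombination R g)) := by
  obtain ⟨e⟩ := exists_equiv_syzygy_one R
  have : Module.Finite R (syzygy R 1 (ModuleCat.of R (ResidueField R))) := .equiv e.symm
  obtain ⟨G, _, g, hg, ⟨e'⟩⟩ :=
    exists_equiv_ker_minimalCover R (syzygy R 1 (ModuleCat.of R (ResidueField R)))
  let f := (maximalIdeal R).subtype ∘ₗ e.toLinearMap
  refine ⟨G, inferInstance, f ∘ g, ?_, ⟨e' ≪≫ₗ .ofEq _ _ ?_⟩⟩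
  · rw [Set.range_comp, Submodule.span_image, hg, Submodule.map_top, LinearMap.range_comp,
      LinearEquiv.range, Submodule.map_top, Submodule.range_subtype]
  · have hcomp : Fintype.linearCombination R (f ∘ g) = f ∘ₗ Fintype.linearCombination R g :=
      LinearMap.ext fun h => by simp [Fintype.linearCombination_apply]
    rw [hcomp, LinearMap.ker_comp_of_ker_eq_bot]
    exact LinearMap.ker_eq_bot.2 (Subtype.val_injective.comp e.injective)

end Syzygies

/-! ### Relations between power series of weight zero -/

theorem isWeaklyRegular_pair_pi {R N : Type*} [CommRing R] [AddCommGroup N] [Module R N]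
    {x y : R} (h : IsWeaklyRegular N [x, y]) (ι : Type*) : IsWeaklyRegular (ι → N) [x, y] := by
  rw [isWeaklyRegular_pair_iff] at *
  refine ⟨fun z hz => funext fun i => h.1 _ (congrFun hz i), fun z w hzw => ?_⟩
  choose t ht using fun i => h.2 (z i) (w i) (congrFun hzw i)
  exact ⟨t, funext ht⟩

theorem isWeaklyRegular_pair_ker {R M N : Type*} [CommRing R] [AddCommGroup M] [Module R M]
    [AddCommGroup N] [Module R N] {x y : R} (hM : IsWeaklyRegular M [x, y])
    (hN : IsSMulRegular N x) (f : M →ₗ[R] N) : IsWeaklyRegular (LinearMap.ker f) [x, y] := by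
  rw [isWeaklyRegular_pair_iff] at *
  refine ⟨fun z hz => Subtype.ext (hM.1 _ (congrArg Subtype.val hz)), fun z w hzw => ?_⟩
  obtain ⟨t, ht⟩ := hM.2 z w (congrArg Subtype.val hzw)
  refine ⟨⟨t, hN ?_⟩, Subtype.ext ht⟩
  simp only [← map_smul, ← ht, LinearMap.map_coe_ker, smul_zero]

section Relations

variable {σ Γ k G : Type*} [AddCommGroup Γ] [Field k] {w : σ → Γ} [Fintype G]

/-- The relations over the ring of power series between power series of weight zero. -/
def relations (g : G → weightRing k w) : Submodule (MvPowerSeries σ k) (G → MvPowerSeries σ k) :=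
  LinearMap.ker (Fintype.linearCombination (MvPowerSeries σ k)
    fun s => (g s : MvPowerSeries σ k))

theorem mem_relations {g : G → weightRing k w} {h : G → MvPowerSeries σ k} :
    h ∈ relations g ↔ ∑ s, h s * g s = 0 := by
  rw [relations, LinearMap.mem_ker, Fintype.linearCombination_apply]
  rfl

theorem weightProj_comp_mem_relations {g : G → weightRing k w} {h : G → MvPowerSeries σ k}
    (hh : h ∈ relations g) (χ : Γ) : (fun s => weightProj k w χ (h s)) ∈ relations g := by
  rw [mem_relations] at *
  rw [← map_zero (weightProj k w χ), ← hh, map_sum]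
  refine Finset.sum_congr rfl fun s _ => ?_
  have := weightProj_mul (g s).2 χ (h s)
  rw [zero_add] at this
  rw [mul_comm (h s), this, mul_comm]

/-- The grading of the module of relations by the weights of the coefficients. -/
def relationsGrading [Fintype Γ] (g : G → weightRing k w) : WeightGrading k w (relations g) where
  proj χ :=
    { toFun h := ⟨_, weightProj_comp_mem_relations h.2 χ⟩
      map_zero' := Subtype.ext (funext fun _ => map_zero _)
      map_add' h h' := Subtype.ext (funext fun _ => map_add _ _ _) }
  sum_proj h := by
    apply Subtype.ext
    rw [AddSubmonoidClass.coe_finsetSum]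
    funext s
    rw [Finset.sum_apply]
    exact sum_weightProj _
  proj_proj χ h := Subtype.ext (funext fun s => weightProj_of_mem (weightProj_mem _ _))
  proj_proj_of_ne hne h :=
    Subtype.ext (funext fun s => weightProj_of_mem_of_ne hne (weightProj_mem _ _))
  proj_smul hf ψ h := Subtype.ext (funext fun s => weightProj_mul hf ψ _)

theorem proj_relationsGrading_eq_iff [Fintype Γ] {g : G → weightRing k w} {χ : Γ}
    {h : relations g} :
    (relationsGrading g).proj χ h = h ↔ ∀ s, h.1 s ∈ weightPart k w χ := by
  rw [Subtype.ext_iff, funext_iff]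
  exact forall_congr' fun s => ⟨fun hs => hs ▸ weightProj_mem _ _, weightProj_of_mem⟩

/-- The relations over the base ring are the relations of degree zero. -/
def relationsZeroPartEquiv [Fintype Γ] (g : G → weightRing k w) :
    LinearMap.ker (Fintype.linearCombination (weightRing k w) g)
      ≃ₗ[weightRing k w] (relationsGrading g).zeroPart where
  toFun h := ⟨⟨fun s => h.1 s, by
      have := congrArg Subtype.val (LinearMap.mem_ker.1 h.2)
      rwa [Fintype.linearCombination_apply, AddSubmonoidClass.coe_finsetSum] at this⟩,
    proj_relationsGrading_eq_iff.2 fun s => (h.1 s).2⟩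
  map_add' _ _ := rfl
  map_smul' _ _ := rfl
  invFun h := ⟨fun s => ⟨h.1.1 s, proj_relationsGrading_eq_iff.1 h.2 s⟩, by
    rw [LinearMap.mem_ker, Fintype.linearCombination_apply]
    apply Subtype.ext
    rw [AddSubmonoidClass.coe_finsetSum]
    exact mem_relations.1 h.1.2⟩

theorem isKoszulExact_relations {w : Fin 2 → Γ} (g : G → weightRing k w) :
    IsKoszulExact (relations g) (X 0 : MvPowerSeries (Fin 2) k) (X 1) := by
  have hX := isWeaklyRegular_X_pow_X_pow (k := k) (zero_ne_one' (Fin 2)) 1 1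
  simp only [pow_one] at hX
  exact .of_isWeaklyRegular (Ideal.subset_span (by simp)) (Ideal.subset_span (by simp))
    (isWeaklyRegular_pair_ker (isWeaklyRegular_pair_pi hX G)
      ((isWeaklyRegular_cons_iff _ _ _).1 hX).1 _)

theorem coeff_single_eq_zero_of_mem_map_maximalIdeal {f : MvPowerSeries σ k}
    (hf : f ∈ (maximalIdeal (weightRing k w)).map
      (algebraMap (weightRing k w) (MvPowerSeries σ k)))
    {s : σ} {j : ℕ} (hj : j < addOrderOf (w s)) : coeff (Finsupp.single s j) f = 0 := by
  classical
  induction hf using Submodule.span_induction generalizing j with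
  | mem f hf =>
    obtain ⟨r, hr, rfl⟩ := hf
    rcases j.eq_zero_or_pos with rfl | hj0
    · rw [Finsupp.single_zero]
      exact mem_maximalIdeal_weightRing_iff.1 hr
    · by_contra hne
      have hw := r.2 _ hne
      rw [Finsupp.weight_single, ← addOrderOf_dvd_iff_nsmul_eq_zero] at hw
      exact Nat.not_dvd_of_pos_of_lt hj0 hj hw
  | zero => simp
  | add f f' _ _ hf hf' => rw [map_add, hf hj, hf' hj, add_zero]
  | smul c f _ hf =>
    rw [smul_eq_mul, coeff_mul, Finsupp.antidiagonal_single, Finset.sum_map]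
    refine Finset.sum_eq_zero fun p hp => ?_
    have hp : p.2 ≤ j := Finset.HasAntidiagonal.antidiagonal.snd_le hp
    exact mul_eq_zero_of_right _ (hf (hp.trans_lt hj))

theorem X_pow_notMem_map_maximalIdeal {s : σ} {j : ℕ} (hj : j < addOrderOf (w s)) :
    (X s : MvPowerSeries σ k) ^ j ∉ (maximalIdeal (weightRing k w)).map
      (algebraMap (weightRing k w) (MvPowerSeries σ k)) := by
  intro h
  have h := coeff_single_eq_zero_of_mem_map_maximalIdeal h hj
  rw [X_pow_eq, coeff_monomial_same] at h
  exact one_ne_zero h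

theorem exists_sum_mul_eq_of_span_range_eq_maximalIdeal {g : G → weightRing k w}
    (hg : Submodule.span (weightRing k w) (Set.range g) = maximalIdeal (weightRing k w))
    {f : MvPowerSeries σ k} (hf : f ∈ weightPart k w 0) (hf0 : constantCoeff f = 0) :
    ∃ c : G → weightRing k w, ∑ s, (c s : MvPowerSeries σ k) * g s = f := by
  have hmem : (⟨f, hf⟩ : weightRing k w) ∈ maximalIdeal (weightRing k w) :=
    mem_maximalIdeal_weightRing_iff.2 hf0
  rw [← hg, Submodule.mem_span_range_iff_exists_fun] at hmem
  obtain ⟨c, hc⟩ := hmem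
  have hc := congrArg Subtype.val hc
  rw [AddSubmonoidClass.coe_finsetSum] at hc
  exact ⟨c, hc⟩

theorem exists_sum_mul_eq_X_zero_mul_of_mem_maximalIdeal_smul_top {w : Fin 2 → Γ}
    {g : G → weightRing k w} {z : relations g}
    (hz : z ∈ maximalIdeal (MvPowerSeries (Fin 2) k) •
      (⊤ : Submodule (MvPowerSeries (Fin 2) k) (relations g)))
    {α γ : G → MvPowerSeries (Fin 2) k} (hαγ : ∀ s, z.1 s = X 1 * α s - X 0 * γ s) :
    ∃ c : G → MvPowerSeries (Fin 2) k, ∑ s, α s * g s = X 0 * ∑ s, c s * g s := by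
  rw [maximalIdeal_eq_span_X_pair, Ideal.span_insert, Submodule.sup_smul,
    Submodule.ideal_span_singleton_smul, Submodule.ideal_span_singleton_smul,
    Submodule.mem_sup] at hz
  obtain ⟨-, ⟨x, -, rfl⟩, -, ⟨y, -, rfl⟩, hxy⟩ := hz
  have hs (s : G) : X 0 * x.1 s + X 1 * y.1 s = X 1 * α s - X 0 * γ s := by
    rw [← hαγ, ← hxy]
    rfl
  have hdvd (s : G) : (X 0 : MvPowerSeries (Fin 2) k) ∣ α s - y.1 s := by
    rw [← pow_one (X 0)]
    refine X_pow_dvd_of_dvd_X_pow_mul (zero_ne_one' (Fin 2)) (j := 1) ⟨x.1 s + γ s, ?_⟩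
    linear_combination -hs s
  choose c hc using hdvd
  refine ⟨c, ?_⟩
  rw [← sub_zero (∑ s, α s * (g s : MvPowerSeries (Fin 2) k)), ← mem_relations.1 y.2,
    ← Finset.sum_sub_distrib, Finset.mul_sum]
  exact Finset.sum_congr rfl fun s _ => by rw [← sub_mul, hc, mul_assoc]

theorem exists_addOrderOf_eq_add_add_one [Finite Γ] {χ : Γ}
    (hχ : AddSubgroup.zmultiples χ = ⊤) (ψ : Γ) :
    ∃ i m, addOrderOf χ = i + (m + 1) ∧ i • χ = -ψ ∧ (m + 1) • χ = ψ := by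
  classical
  obtain ⟨m, hm, hmχ⟩ := Finset.mem_image.1
    (mem_zmultiples_iff_mem_range_addOrderOf.1 (hχ.ge (AddSubgroup.mem_top (ψ - χ))))
  obtain ⟨i, hi⟩ := Nat.exists_eq_add_of_lt (Finset.mem_range.1 hm)
  have hψ : (m + 1) • χ = ψ := by rw [add_nsmul, hmχ, one_nsmul, sub_add_cancel]
  refine ⟨i, m, by lia, ?_, hψ⟩
  rw [eq_neg_iff_add_eq_zero, ← hψ, ← add_nsmul, show i + (m + 1) = addOrderOf χ by lia,
    addOrderOf_nsmul_eq_zero]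

theorem exists_relation_notMem_maximalIdeal_smul_top [Fintype Γ] {w : Fin 2 → Γ}
    (hw : AddSubgroup.zmultiples (w 0) = ⊤) {g : G → weightRing k w}
    (hg : Submodule.span (weightRing k w) (Set.range g) = maximalIdeal (weightRing k w)) :
    ∃ z : relations g, (relationsGrading g).proj (w 1) z = z ∧
      z ∉ maximalIdeal (MvPowerSeries (Fin 2) k) •
        (⊤ : Submodule (MvPowerSeries (Fin 2) k) (relations g)) := by
  obtain ⟨i, m, hm, hi, hmw⟩ := exists_addOrderOf_eq_add_add_one hw (w 1)
  have hX0 (j : ℕ) : (X 0 : MvPowerSeries (Fin 2) k) ^ j ∈ weightPart k w (j • w 0) :=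
    pow_mem_weightPart (X_mem_weightPart 0) j
  obtain ⟨α, hα⟩ := exists_sum_mul_eq_of_span_range_eq_maximalIdeal hg
    (f := X 0 ^ addOrderOf (w 0))
    (by simpa [addOrderOf_nsmul_eq_zero] using hX0 (addOrderOf (w 0))) (by simp [hm])
  obtain ⟨β, hβ⟩ := exists_sum_mul_eq_of_span_range_eq_maximalIdeal hg (f := X 0 ^ i * X 1)
    (by simpa [hi] using mul_mem_weightPart (hX0 i) (X_mem_weightPart 1)) (by simp)
  have hz : (fun s => X 1 * (α s : MvPowerSeries (Fin 2) k) -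
      X 0 ^ (m + 1) * (β s : MvPowerSeries (Fin 2) k)) ∈
      relations g := by
    rw [mem_relations]
    simp only [sub_mul, Finset.sum_sub_distrib, mul_assoc, ← Finset.mul_sum, hα, hβ, hm]
    ring
  refine ⟨⟨_, hz⟩, proj_relationsGrading_eq_iff.2 fun s => sub_mem ?_ ?_, fun hmem => ?_⟩
  · simpa using mul_mem_weightPart (X_mem_weightPart 1) (α s).2
  · simpa [hmw] using mul_mem_weightPart (hX0 (m + 1)) (β s).2
  · obtain ⟨c, hc⟩ := exists_sum_mul_eq_X_zero_mul_of_mem_maximalIdeal_smul_top hmem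
      (α := fun s => α s) (γ := fun s => X 0 ^ m * (β s : MvPowerSeries (Fin 2) k)) fun s => by ring
    rw [hα, hm, ← add_assoc, pow_succ', mul_right_inj' (X_ne_zero 0)] at hc
    refine X_pow_notMem_map_maximalIdeal (k := k) (w := w) (s := 0) (j := i + m) (by lia) ?_
    rw [hc]
    refine sum_mem fun s _ => Ideal.mul_mem_left _ _ (Ideal.mem_map_of_mem _ ?_)
    exact hg.le (Submodule.subset_span ⟨s, rfl⟩)

end Relations

theorem exists_equiv_syzygy_two_pi_weightPart {Γ : Type*} {k : Type u} [AddCommGroup Γ] [Finite Γ]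
    [Field k] {w : Fin 2 → Γ} (hw : ∀ s, AddSubgroup.zmultiples (w s) = ⊤) :
    ∃ (r : ℕ) (χ : Fin r → Γ),
      Nonempty (syzygy (weightRing k w) 2 (ModuleCat.of _ (ResidueField (weightRing k w)))
        ≃ₗ[weightRing k w] ∀ t, weightPart k w (χ t)) ∧
      ∃ t, AddSubgroup.zmultiples (χ t) = ⊤ := by
  cases nonempty_fintype Γ
  obtain ⟨G, _, g, hg, ⟨e⟩⟩ := exists_equiv_syzygy_two (weightRing k w)
  obtain ⟨r, b, χ, hb⟩ := (relationsGrading g).exists_homogeneous_basis (isKoszulExact_relations g)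
  obtain ⟨z, hz, hzm⟩ := exists_relation_notMem_maximalIdeal_smul_top (hw 0) hg
  obtain ⟨t, ht⟩ :=
    (relationsGrading g).exists_degree_eq_of_notMem_maximalIdeal_smul_top b hb hz hzm
  refine ⟨r, fun t => -χ t, ⟨e ≪≫ₗ relationsZeroPartEquiv g ≪≫ₗ
    ((relationsGrading g).zeroPartEquiv b hb).symm⟩, t, ?_⟩
  simp only [ht, AddSubgroup.zmultiples_neg, hw]

/-! ### Equidistribution of the weights of monomials -/

section Equidistribution

variable {Γ : Type*} [AddCommGroup Γ]

theorem abs_sub_le_card_mul_of_forall_abs_add_sub_le [Finite Γ] {χ : Γ}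
    (hχ : AddSubgroup.zmultiples χ = ⊤) {f : Γ → ℝ} {B : ℝ} (hf : ∀ ψ, |f (ψ + χ) - f ψ| ≤ B)
    (φ ψ : Γ) : |f φ - f ψ| ≤ Nat.card Γ * B := by
  classical
  obtain ⟨m, hm, hmχ⟩ := Finset.mem_image.1
    (mem_zmultiples_iff_mem_range_addOrderOf.1 (hχ.ge (AddSubgroup.mem_top (ψ - φ))))
  have hm : m ≤ Nat.card Γ := (Finset.mem_range.1 hm).le.trans addOrderOf_le_card
  have hstep (i : ℕ) : dist (f (φ + i • χ)) (f (φ + (i + 1) • χ)) ≤ B := by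
    rw [dist_comm, Real.dist_eq, succ_nsmul, ← add_assoc]
    exact hf _
  have hsum := dist_le_range_sum_of_dist_le m fun {i} _ => hstep i
  rw [zero_nsmul, add_zero, hmχ, add_sub_cancel, Finset.sum_const, Finset.card_range,
    nsmul_eq_mul, Real.dist_eq] at hsum
  have hB : 0 ≤ B := (abs_nonneg _).trans (hf 0)
  exact hsum.trans (mul_le_mul_of_nonneg_right (by exact_mod_cast hm) hB)

theorem abs_div_sum_sub_one_div_card_le {ι : Type*} [Fintype ι] {f : ι → ℝ} {B : ℝ}
    (hf : 0 < ∑ j, f j) {i : ι} (hB : ∀ j, |f i - f j| ≤ B) :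
    |f i / ∑ j, f j - 1 / Nat.card ι| ≤ B / ∑ j, f j := by
  have : Nonempty ι := ⟨i⟩
  have hcard : (0 : ℝ) < Nat.card ι := Nat.cast_pos.2 Nat.card_pos
  have hsum : |Nat.card ι * f i - ∑ j, f j| ≤ Nat.card ι * B := by
    calc |Nat.card ι * f i - ∑ j, f j| = |∑ j, (f i - f j)| := by simp
      _ ≤ ∑ j, |f i - f j| := Finset.abs_sum_le_sum_abs _ _
      _ ≤ ∑ _ : ι, B := Finset.sum_le_sum fun j _ => hB j
      _ = Nat.card ι * B := by simp
  rw [div_sub_div _ _ hf.ne' hcard.ne', abs_div, abs_of_pos (mul_pos hf hcard),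
    div_le_div_iff₀ (mul_pos hf hcard) hf]
  calc |f i * Nat.card ι - (∑ j, f j) * 1| * ∑ j, f j
      = |Nat.card ι * f i - ∑ j, f j| * ∑ j, f j := by rw [mul_comm (f i), mul_one]
    _ ≤ Nat.card ι * B * ∑ j, f j := mul_le_mul_of_nonneg_right hsum hf.le
    _ = B * ((∑ j, f j) * Nat.card ι) := by ring

theorem abs_sum_range_add_sub_sum_range_le [Fintype Γ] {c : ℕ → Γ → ℝ} {χ : Γ}
    (hc : ∀ q ψ, 0 ≤ c q ψ) (hmono : ∀ q ψ, c q ψ ≤ c (q + 1) (ψ + χ)) (N : ℕ) (ψ : Γ) :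
    |∑ q ∈ Finset.range (N + 1), c q (ψ + χ) - ∑ q ∈ Finset.range (N + 1), c q ψ| ≤
      ∑ φ, c N φ := by
  let d (φ : Γ) : ℝ :=
    ∑ q ∈ Finset.range (N + 1), c q (φ + χ) - ∑ q ∈ Finset.range N, c q φ
  have hd0 (φ : Γ) : 0 ≤ d φ := by
    refine sub_nonneg.2 ?_
    rw [Finset.sum_range_succ']
    exact le_add_of_le_of_nonneg (Finset.sum_le_sum fun q _ => hmono q φ) (hc 0 _)
  have hdsum : ∑ φ, d φ = ∑ φ, c N φ := by
    have hshift : ∑ φ, ∑ q ∈ Finset.range (N + 1), c q (φ + χ) =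
        ∑ φ, ∑ q ∈ Finset.range (N + 1), c q φ :=
      Equiv.sum_comp (Equiv.addRight χ) fun φ => ∑ q ∈ Finset.range (N + 1), c q φ
    rw [Finset.sum_sub_distrib, hshift, ← Finset.sum_sub_distrib]
    exact Finset.sum_congr rfl fun φ _ => by rw [Finset.sum_range_succ, add_sub_cancel_left]
  have hdle : d ψ ≤ ∑ φ, c N φ :=
    hdsum ▸ Finset.single_le_sum (fun φ _ => hd0 φ) (Finset.mem_univ ψ)
  have hcle : c N ψ ≤ ∑ φ, c N φ :=
    Finset.single_le_sum (fun φ _ => hc N φ) (Finset.mem_univ ψ)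
  rw [Finset.sum_range_succ (fun q => c q ψ), ← sub_sub, abs_sub_le_iff]
  constructor <;> linarith [hd0 ψ, hc N ψ]

theorem tendsto_sum_div_sum_sum [Fintype Γ] {c : ℕ → Γ → ℝ} {χ : Γ}
    (hχ : AddSubgroup.zmultiples χ = ⊤) (hc : ∀ q ψ, 0 ≤ c q ψ)
    (hmono : ∀ q ψ, c q ψ ≤ c (q + 1) (ψ + χ)) (hc0 : 0 < ∑ ψ, c 0 ψ)
    (hlim : Tendsto (fun N => (∑ ψ, c N ψ) / ∑ q ∈ Finset.range (N + 1), ∑ ψ, c q ψ)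
      atTop (𝓝 0)) (ψ : Γ) :
    Tendsto (fun N => (∑ q ∈ Finset.range (N + 1), c q ψ) /
      ∑ q ∈ Finset.range (N + 1), ∑ φ, c q φ) atTop (𝓝 (1 / Nat.card Γ)) := by
  have hpos (N : ℕ) : 0 < ∑ q ∈ Finset.range (N + 1), ∑ φ, c q φ :=
    hc0.trans_le (Finset.single_le_sum (f := fun q => ∑ φ, c q φ)
      (fun q _ => Finset.sum_nonneg fun φ _ => hc q φ) (Finset.mem_range.2 N.succ_pos))
  have hbound := hlim.const_mul (Nat.card Γ : ℝ)
  rw [mul_zero] at hbound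
  refine tendsto_iff_dist_tendsto_zero.2 (squeeze_zero (fun _ => dist_nonneg) (fun N => ?_) hbound)
  have hclose := abs_sub_le_card_mul_of_forall_abs_add_sub_le hχ
    (f := fun φ => ∑ q ∈ Finset.range (N + 1), c q φ)
    (abs_sum_range_add_sub_sum_range_le hc hmono N) ψ
  have hcomm := Finset.sum_comm (s := Finset.range (N + 1)) (t := Finset.univ) (f := c)
  rw [Real.dist_eq, ← mul_div_assoc, hcomm]
  exact abs_div_sum_sub_one_div_card_le (hcomm ▸ hpos N) hclose

theorem multichoose_div_sum_range_multichoose {r : ℕ} (hr : 0 < r) (N : ℕ) :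
    (r.multichoose N : ℝ) / ∑ q ∈ Finset.range (N + 1), (r.multichoose q : ℝ) = r / (r + N) := by
  obtain ⟨s, rfl⟩ := Nat.exists_eq_add_one.2 hr
  have hchoose : (s + 1 + N) * (s + 1).multichoose N = (s + 1) * (N + (s + 1)).choose (s + 1) := by
    have h := Nat.add_one_mul_choose_eq (s + N) s
    rw [Nat.multichoose_eq, add_right_comm, Nat.add_sub_cancel, ← Nat.choose_symm_add, h, mul_comm,
      add_left_comm, ← add_assoc]
  have hpos : 0 < (N + (s + 1)).choose (s + 1) := Nat.choose_pos (Nat.le_add_left _ _)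
  rw [← Nat.cast_sum, Nat.sum_range_multichoose, div_eq_div_iff (by positivity) (by positivity),
    mul_comm]
  exact_mod_cast hchoose

theorem tendsto_multichoose_div_sum_range_multichoose {r : ℕ} (hr : 0 < r) :
    Tendsto (fun N : ℕ => (r.multichoose N : ℝ) /
      ∑ q ∈ Finset.range (N + 1), (r.multichoose q : ℝ)) atTop (𝓝 0) := by
  simp only [multichoose_div_sum_range_multichoose hr]
  exact tendsto_const_nhds.div_atTop
    (tendsto_atTop_add_const_left _ _ tendsto_natCast_atTop_atTop)

theorem natCard_monomialWeight_le {T : Type*} [Finite T] (χ : T → Γ) (t : T) (q : ℕ) (ψ : Γ) :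
    Nat.card {m : Sym T q // monomialWeight χ m = ψ} ≤
      Nat.card {m : Sym T (q + 1) // monomialWeight χ m = ψ + χ t} := by
  refine Nat.card_le_card_of_injective (fun m => ⟨t ::ₛ m.1, ?_⟩) fun m m' h =>
    Subtype.ext ((Sym.cons_inj_right t _ _).1 (congrArg Subtype.val h))
  rw [monomialWeight, Sym.coe_cons, Multiset.map_cons, Multiset.sum_cons, add_comm,
    ← monomialWeight, m.2]

theorem tendsto_natCard_monomialWeight_div_natCard_sym [Finite Γ] {T : Type*} [Finite T]
    {χ : T → Γ} {t : T} (ht : AddSubgroup.zmultiples (χ t) = ⊤) (ψ : Γ) :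
    Tendsto (fun N : ℕ => (∑ q ∈ Finset.range (N + 1),
        (Nat.card {m : Sym T q // monomialWeight χ m = ψ} : ℝ)) /
      ∑ q ∈ Finset.range (N + 1), (Nat.card (Sym T q) : ℝ)) atTop (𝓝 (1 / Nat.card Γ)) := by
  cases nonempty_fintype Γ
  have hsum (q : ℕ) : ∑ φ, (Nat.card {m : Sym T q // monomialWeight χ m = φ} : ℝ) =
      (Nat.card T).multichoose q := by
    rw [← Nat.cast_sum, ← Nat.card_sigma, ← Sym.natCard_sym_eq_multichoose]
    exact congrArg _ (Nat.card_congr (Equiv.sigmaFiberEquiv _))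
  have : Nonempty T := ⟨t⟩
  have hlim := tendsto_sum_div_sum_sum ht
    (c := fun q φ => (Nat.card {m : Sym T q // monomialWeight χ m = φ} : ℝ))
    (fun _ _ => Nat.cast_nonneg _)
    (fun q φ => Nat.cast_le.2 (natCard_monomialWeight_le χ t q φ))
    (by simp [hsum])
    (by simpa only [hsum] using tendsto_multichoose_div_sum_range_multichoose Nat.card_pos) ψ
  simpa only [hsum, Sym.natCard_sym_eq_multichoose] using hlim

end Equidistribution

/-! ### Symmetric signatures of weight rings and of cyclic quotient singularities -/

section Signature

variable {Γ : Type*} {k : Type u} [AddCommGroup Γ] [Finite Γ] [Field k] {w : Fin 2 → Γ}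

theorem dim_weightRing (w : Fin 2 → Γ) : dim (weightRing k w) = 2 := by
  rw [dim, ringKrullDim_weightRing]
  rfl

variable (hw : ∀ s, AddSubgroup.zmultiples (w s) = ⊤)

include hw

theorem exists_equiv_symSyz_pi_weightPart :
    ∃ (r : ℕ) (χ : Fin r → Γ), (∃ t, AddSubgroup.zmultiples (χ t) = ⊤) ∧
      ∀ q, Nonempty (SymSyz (weightRing k w) q ≃ₗ[weightRing k w]
        ∀ m : Sym (Fin r) q, weightPart k w (monomialWeight χ m)) := by
  obtain ⟨r, χ, ⟨e⟩, hχ⟩ := exists_equiv_syzygy_two_pi_weightPart (k := k) hw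
  refine ⟨r, χ, hχ, fun q => ?_⟩
  unfold SymSyz
  rw [dim_weightRing]
  exact exists_equiv_reflexiveSymmetricPower hw q e

theorem hasGeneralizedSymmetricSignature_weightRing {M : Type v} [AddCommGroup M]
    [Module (weightRing k w) M] (hM : IsMCM (weightRing k w) M)
    (hM' : IsIndecomposable (weightRing k w) M) :
    HasGeneralizedSymmetricSignature (weightRing k w) M (1 / Nat.card Γ) := by
  obtain ⟨ψ, ⟨eM⟩⟩ := hM.exists_equiv_weightPart (hw 0) hM'
  obtain ⟨r, χ, ⟨t, ht⟩, hX⟩ := exists_equiv_symSyz_pi_weightPart (k := k) hw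
  have hrank (q : ℕ) : rank (weightRing k w) (SymSyz (weightRing k w) q) =
      Nat.card (Sym (Fin r) q) :=
    (hX q).elim fun e => rank_eq_natCard_of_equiv_pi_weightPart (hw 0) e
  refine ⟨fun q => Nat.card {m : Sym (Fin r) q // monomialWeight χ m = ψ},
    fun q b => (hX q).elim fun e => isMultiplicity_iff_of_equiv_weightPart hw eM e b, ?_⟩
  simp only [hrank]
  exact tendsto_natCard_monomialWeight_div_natCard_sym ht ψ

theorem hasSymmetricSignature_weightRing :
    HasSymmetricSignature (weightRing k w) (1 / Nat.card Γ) := by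
  obtain ⟨r, χ, ⟨t, ht⟩, hX⟩ := exists_equiv_symSyz_pi_weightPart (k := k) hw
  have hrank (q : ℕ) : rank (weightRing k w) (SymSyz (weightRing k w) q) =
      Nat.card (Sym (Fin r) q) :=
    (hX q).elim fun e => rank_eq_natCard_of_equiv_pi_weightPart (hw 0) e
  have hfreeRank (q : ℕ) : freeRank (weightRing k w) (SymSyz (weightRing k w) q) =
      Nat.card {m : Sym (Fin r) q // monomialWeight χ m = 0} :=
    (hX q).elim fun e => freeRank_eq_of_equiv_pi_weightPart hw e
  simp only [HasSymmetricSignature, hrank, hfreeRank]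
  exact tendsto_natCard_monomialWeight_div_natCard_sym ht 0

theorem symmetricSignatures_of_eq_weightRing {A : Subalgebra k (MvPowerSeries (Fin 2) k)}
    [IsLocalRing A] (hA : A = weightRing k w) :
    (∀ (M : Type v) [AddCommGroup M] [Module A M], IsMCM A M → IsIndecomposable A M →
      HasGeneralizedSymmetricSignature A M (1 / Nat.card Γ)) ∧
    HasSymmetricSignature A (1 / Nat.card Γ) := by
  subst hA
  exact ⟨fun _ _ _ => hasGeneralizedSymmetricSignature_weightRing hw,
    hasSymmetricSignature_weightRing hw⟩

end Signature

section CyclicGroup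

variable {k : Type u} [Field k] {ξ : kˣ} {n : ℕ}

/-- The homomorphism `ξ ↦ diag(ξ, ξ ^ a)`. It identifies `cyclicGroup ξ a` with the group
generated by `ξ`. -/
def diagHom (a : ℕ) : kˣ →* GL (Fin 2) k where
  toFun ξ := diagGenerator ξ a
  map_one' := by
    ext i j
    fin_cases i <;> fin_cases j <;> simp [diagGenerator]
  map_mul' ξ η := by
    ext i j
    fin_cases i <;> fin_cases j <;> simp [diagGenerator, mul_pow]

theorem diagHom_injective (a : ℕ) : Function.Injective (diagHom (k := k) a) := by
  intro ξ η h
  have hentry := congrArg (fun g : GL (Fin 2) k => g 0 0) h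
  ext
  simpa [diagHom, diagGenerator] using hentry

theorem natCard_cyclicGroup (hξ : IsPrimitiveRoot ξ n) (a : ℕ) :
    Nat.card (cyclicGroup ξ a) = n := by
  rw [cyclicGroup, Nat.card_zpowers, hξ.eq_orderOf]
  exact orderOf_injective (diagHom a) (diagHom_injective a) ξ

theorem coeff_linearAction_diagGenerator (ξ : kˣ) (a : ℕ) (f : MvPowerSeries (Fin 2) k)
    (d : Fin 2 →₀ ℕ) :
    coeff d (linearAction (diagGenerator ξ a) f) = (ξ : k) ^ (d 0 + a * d 1) * coeff d f := by
  have hrescale : linearAction (diagGenerator ξ a) f = rescale ![(ξ : k), (ξ : k) ^ a] f := by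
    rw [rescale_eq_subst, linearAction, substAlgHom_apply]
    congr 1
    funext j
    fin_cases j <;> simp [diagGenerator, Fin.sum_univ_two]
  rw [hrescale, coeff_rescale, Finsupp.prod_fintype _ _ (fun i => pow_zero _), Fin.prod_univ_two]
  simp [pow_add, pow_mul]

theorem weight_eq_zero_iff (n a : ℕ) (d : Fin 2 →₀ ℕ) :
    Finsupp.weight ![(1 : ZMod n), (a : ZMod n)] d = 0 ↔ n ∣ d 0 + a * d 1 := by
  rw [Finsupp.weight_apply, Finsupp.sum_fintype _ _ (by simp), Fin.sum_univ_two,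
    ← ZMod.natCast_eq_zero_iff]
  simp [mul_comm]

theorem cyclicSingularity_eq_weightRing (hξ : IsPrimitiveRoot ξ n) (a : ℕ) :
    cyclicSingularity ξ a = weightRing k ![(1 : ZMod n), (a : ZMod n)] := by
  ext f
  constructor
  · intro hf d hd
    have hcoeff := congrArg (coeff d) (hf (diagGenerator ξ a) (Subgroup.mem_zpowers _))
    rw [coeff_linearAction_diagGenerator] at hcoeff
    rw [weight_eq_zero_iff, ← hξ.pow_eq_one_iff_dvd]
    ext
    push_cast
    exact mul_right_cancel₀ hd (hcoeff.trans (one_mul _).symm)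
  · rintro hf g ⟨i, rfl⟩
    change linearAction (diagHom a ξ ^ i) f = f
    rw [← map_zpow]
    ext d
    refine (coeff_linearAction_diagGenerator _ _ _ _).trans ?_
    by_cases hd : coeff d f = 0
    · rw [hd, mul_zero]
    · have hroot : ξ ^ (d 0 + a * d 1) = 1 :=
        (hξ.pow_eq_one_iff_dvd _).2 ((weight_eq_zero_iff n a d).1 (hf d hd))
      have hroot' : (ξ ^ i) ^ (d 0 + a * d 1) = 1 := by
        rw [← zpow_natCast, zpow_comm, zpow_natCast, hroot, one_zpow]
      rw [← Units.val_pow_eq_pow_val, hroot', Units.val_one, one_mul]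

theorem zmultiples_natCast_eq_top_of_coprime {a : ℕ} (ha : Nat.Coprime a n) :
    AddSubgroup.zmultiples (a : ZMod n) = ⊤ := by
  refine (AddSubgroup.eq_top_iff' _).2 fun x => ?_
  obtain ⟨y, hy⟩ := ZMod.intCast_surjective (x * (ZMod.unitOfCoprime a ha)⁻¹ : ZMod n)
  refine ⟨y, ?_⟩
  change y • (a : ZMod n) = x
  rw [zsmul_eq_mul, hy, ← ZMod.coe_unitOfCoprime a ha, Units.inv_mul_cancel_right]

end CyclicGroup

end SymmetricSignature

end

theorem theorem4p5p6_general {k : Type u} [Field k] (n a : ℕ) [NeZero n]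
    (ha : Nat.Coprime a n) (ξ : kˣ) (hξ : IsPrimitiveRoot ξ n) :
    (∀ (M : Type v) [AddCommGroup M] [Module (SymmetricSignature.cyclicSingularity ξ a) M],
        SymmetricSignature.IsMCM (SymmetricSignature.cyclicSingularity ξ a) M →
        SymmetricSignature.IsIndecomposable (SymmetricSignature.cyclicSingularity ξ a) M →
        SymmetricSignature.HasGeneralizedSymmetricSignature
          (SymmetricSignature.cyclicSingularity ξ a) M
          (1 / (Nat.card (SymmetricSignature.cyclicGroup ξ a) : ℝ))) ∧
    SymmetricSignature.HasSymmetricSignature (SymmetricSignature.cyclicSingularity ξ a)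
      (1 / (Nat.card (SymmetricSignature.cyclicGroup ξ a) : ℝ)) := by
  have hw (s : Fin 2) : AddSubgroup.zmultiples (![(1 : ZMod n), (a : ZMod n)] s) = ⊤ := by
    have h1 := SymmetricSignature.zmultiples_natCast_eq_top_of_coprime (Nat.coprime_one_left n)
    fin_cases s
    · exact Nat.cast_one (R := ZMod n) ▸ h1
    · exact SymmetricSignature.zmultiples_natCast_eq_top_of_coprime ha
  have hcard : Nat.card (SymmetricSignature.cyclicGroup ξ a) = Nat.card (ZMod n) := by
    rw [SymmetricSignature.natCard_cyclicGroup hξ a, Nat.card_zmod]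
  rw [hcard]
  exact SymmetricSignature.symmetricSignatures_of_eq_weightRing hw
    (SymmetricSignature.cyclicSingularity_eq_weightRing hξ a)

theorem theorem4p5p6 {k : Type u} [Field k] [IsAlgClosed k] (n a : ℕ)
    (hchar : ¬ ringChar k ∣ n) (ha : Nat.Coprime a n) (ξ : kˣ) (hξ : IsPrimitiveRoot ξ n) :
    (∀ (M : Type v) [AddCommGroup M] [Module (SymmetricSignature.cyclicSingularity ξ a) M],
        SymmetricSignature.IsMCM (SymmetricSignature.cyclicSingularity ξ a) M →
        SymmetricSignature.IsIndecomposable (SymmetricSignature.cyclicSingularity ξ a) M →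
        SymmetricSignature.HasGeneralizedSymmetricSignature
          (SymmetricSignature.cyclicSingularity ξ a) M
          (1 / (Nat.card (SymmetricSignature.cyclicGroup ξ a) : ℝ))) ∧
    SymmetricSignature.HasSymmetricSignature (SymmetricSignature.cyclicSingularity ξ a)
      (1 / (Nat.card (SymmetricSignature.cyclicGroup ξ a) : ℝ)) := by
  have : NeZero n := ⟨fun hn => hchar (hn ▸ dvd_zero _)⟩
  exact theorem4p5p6_general n a ha ξ hξ
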